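/- Let $X=\{0,1\}^{\mathbb Z}\times\{0,1\}$ with the product probability measure $\mu$ giving each bit weight $1/2$; a point $(x,S)\in X$ is regarded as a state of a Turing machine with tape $x=(x_k)_{k\in\mathbb Z}$ and signal $S$. Let $\mathcal R$ be the orbit equivalence relation on $X$ of the countable group $(\mathbb Z/2\wr\mathbb Z)\times\mathbb Z/2$ of $\mu$-preserving transformations generated by the shift of the tape, the change of the entry $x_0$, and the change of the signal. Let $[\mathcal R]$ be the full group of $\mathcal R$: the group of $\mu$-preserving automorphisms $g$ of $X$ with $g(p)\mathrel{\mathcal R}p$ for almost every $p$, modulo equality almost everywhere, with the metric $d(g,h)=\mu(\{p : gh^{-1}p\neq p\})$. Let $R$ be the von Neumann algebra of $\mathcal R$, i.e. the von Neumann algebra on $L^2(\mathcal R,\nu)$, $\nu(E)=\int_X \#\{p : (p,q)\in E\}\,d\mu(q)$, generated by the multiplications by functions in $L^\infty(X)$ of the left coordinate and the unitaries $(u_g\xi)(p,q)=\xi(g^{-1}p,q)$, $g\in[\mathcal R]$; let $\tau(a)=\langle a\,1_\Delta,1_\Delta\rangle$ be its canonical trace ($\Delta$ the diagonal), and let $\|a\|_2=\tau(a^*a)^{1/2}$.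 Let $u,v\in[\mathcal R]$ be given by the following commands. - $u$: if $S=0$, shift the tape to the left (the new tape is $(x_{k+1})_k$) and set $S:=1$; if $S=1$, shift the tape to the right and set $S:=0$. - $v$: permute the pair $(x_0,S)$ by $(0,0)\mapsto(0,0)$, $(0,1)\mapsto(1,1)\mapsto(1,0)\mapsto(0,1)$, and leave the rest of the tape unchanged. **Theorem.** The relation $\mathcal R$ is ergodic and hyperfinite (off a $\mu$-null set it is the union of an increasing sequence of measurable equivalence relations with finite classes). The elements $u$ and $v$ have order $2$ and $3$, and there is an injective homomorphism $\varphi:\mathrm{PSL}_2(\mathbb Z)\to[\mathcal R]$ with image $\langle u,v\rangle$ that sends the class of $\begin{pmatrix}0&-1\\1&0\end{pmatrix}$ to $u$ and the class of $\begin{pmatrix}0&-1\\1&1\end{pmatrix}$ to $v$. This copy $\langle u,v\rangle$ of $\mathrm{PSL}_2(\mathbb Z)$ is not discrete as a subgroup of $([\mathcal R],d)$. The homomorphism $g\mapsto u_g$ is injective on it, and its image $\langle u_u,u_v\rangle$ in the unitary group ${\rm U}(R)$ is not discrete as a subgroup of $({\rm U}(R),\|\cdot\|_2)$. -/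

import Mathlib

open MeasureTheory
open scoped ENNReal MatrixGroups

noncomputable section

namespace OrbitEquivalence

variable {X : Type*} [MeasurableSpace X]

/-- `G` is a countable group of `μ`-preserving bimeasurable bijections of `X`. Its orbit equivalence
relation is `MulAction.orbitRel G X`. -/
class IsPMP (μ : Measure X) (G : Subgroup (Equiv.Perm X)) : Prop where
  countable : Countable G
  measurePreserving : ∀ g ∈ G, MeasurePreserving g μ μ

/-- The orbit equivalence relation of `G` is hyperfinite (with respect to `μ`): off a null set it is
the increasing union of measurable equivalence relations with finite classes. -/
def IsHyperfinite (μ : Measure X) (G : Subgroup (Equiv.Perm X)) : Prop :=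
  ∃ F : ℕ → Setoid X, (∀ n, MeasurableSet {p : X × X | F n p.1 p.2}) ∧
    (∀ n x, {y | F n x y}.Finite) ∧ Monotone F ∧
    ∀ᵐ x ∂μ, ∀ y, MulAction.orbitRel G X x y ↔ ∃ n, F n x y

/-! ### The full group -/

/-- The bimeasurable `μ`-preserving bijections `T` of `X` with `T x` in the `G`-orbit of `x` for
almost every `x`. -/
def fullGroupRep (μ : Measure X) (G : Subgroup (Equiv.Perm X)) : Subgroup (Equiv.Perm X) where
  carrier := {T | MeasurePreserving T μ μ ∧ Measurable T.symm ∧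
    ∀ᵐ x ∂μ, MulAction.orbitRel G X (T x) x}
  mul_mem' := by
    rintro S T ⟨hS, hS', hSo⟩ ⟨hT, hT', hTo⟩
    refine ⟨hS.comp hT, hT'.comp hS', ?_⟩
    filter_upwards [hTo, hT.quasiMeasurePreserving.ae hSo] with x h1 h2
    exact Setoid.trans' _ h2 h1
  one_mem' := ⟨MeasurePreserving.id μ, measurable_id, ae_of_all _ fun x => Setoid.refl' _ x⟩
  inv_mem' := by
    rintro T ⟨hT, hT', hTo⟩
    let e : X ≃ᵐ X := ⟨T, hT.measurable, hT'⟩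
    have he : MeasurePreserving e.symm μ μ := MeasurePreserving.symm e hT
    refine ⟨he, hT.measurable, ?_⟩
    filter_upwards [he.quasiMeasurePreserving.ae hTo] with x hx
    have h2 : T (e.symm x) = x := e.apply_symm_apply x
    rw [h2] at hx
    exact Setoid.symm' _ hx

/-- The transformations that are equal to the identity almost everywhere. -/
def nullPart (μ : Measure X) (G : Subgroup (Equiv.Perm X)) : Subgroup (fullGroupRep μ G) where
  carrier := {T | ∀ᵐ x ∂μ, T.1 x = x}
  mul_mem' := by
    intro S T hS hT
    change ∀ᵐ x ∂μ, S.1 (T.1 x) = x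
    filter_upwards [hS, hT] with x h1 h2
    rw [h2, h1]
  one_mem' := ae_of_all _ fun x => rfl
  inv_mem' := by
    intro T hT
    change ∀ᵐ x ∂μ, T.1⁻¹ x = x
    filter_upwards [hT] with x h
    exact (Equiv.Perm.inv_eq_iff_eq).2 h.symm

instance (μ : Measure X) (G : Subgroup (Equiv.Perm X)) : (nullPart μ G).Normal where
  conj_mem := by
    intro T hT S
    have hS : MeasurePreserving (S⁻¹).1 μ μ := (S⁻¹).2.1
    filter_upwards [hS.quasiMeasurePreserving.ae hT] with x h
    simp only [Subgroup.coe_mul, Equiv.Perm.mul_apply, h]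
    simp

/-- The full group of the orbit equivalence relation of `G`: transformations are identified when they
agree almost everywhere. -/
def FullGroup (μ : Measure X) (G : Subgroup (Equiv.Perm X)) : Type _ :=
  fullGroupRep μ G ⧸ nullPart μ G

instance (μ : Measure X) (G : Subgroup (Equiv.Perm X)) : Group (FullGroup μ G) :=
  inferInstanceAs (Group (fullGroupRep μ G ⧸ nullPart μ G))

variable {μ : Measure X} {G : Subgroup (Equiv.Perm X)}

/-- The class of a transformation in the full group. -/
def FullGroup.mk : fullGroupRep μ G →* FullGroup μ G := QuotientGroup.mk' (nullPart μ G)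

theorem FullGroup.mk_surjective : Function.Surjective (FullGroup.mk (μ := μ) (G := G)) :=
  QuotientGroup.mk'_surjective _

theorem FullGroup.mk_eq_one {T : fullGroupRep μ G} :
    FullGroup.mk T = 1 ↔ ∀ᵐ x ∂μ, T.1 x = x :=
  QuotientGroup.eq_one_iff (N := nullPart μ G) T

theorem FullGroup.mk_eq_mk {S T : fullGroupRep μ G} :
    FullGroup.mk S = FullGroup.mk T ↔ ∀ᵐ x ∂μ, S.1 x = T.1 x := by
  rw [← inv_mul_eq_one, ← map_inv, ← map_mul, FullGroup.mk_eq_one]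
  simp only [Subgroup.coe_mul, Subgroup.coe_inv, Equiv.Perm.mul_apply, Equiv.Perm.inv_eq_iff_eq]
  constructor <;> intro h <;> filter_upwards [h] with x hx <;> exact hx.symm

/-- The length function `ℓ(g) = μ {x | g x ≠ x}`, the measure of the support. -/
def FullGroup.length (g : FullGroup μ G) : ℝ :=
  Quotient.liftOn g (fun T : fullGroupRep μ G => μ.real {x | T.1 x ≠ x}) fun S T h => by
    have h1 : ∀ᵐ x ∂μ, S.1 x = T.1 x := FullGroup.mk_eq_mk.1 (Quotient.sound h)
    apply measureReal_congr
    filter_upwards [h1] with x hx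
    change (S.1 x ≠ x) = (T.1 x ≠ x)
    rw [hx]

theorem FullGroup.length_mk (T : fullGroupRep μ G) :
    (FullGroup.mk T).length = μ.real {x | T.1 x ≠ x} := rfl

theorem FullGroup.length_mul_inv (S T : fullGroupRep μ G) :
    (FullGroup.mk S * (FullGroup.mk T)⁻¹).length = μ.real {x | S.1 x ≠ T.1 x} := by
  have hT : MeasurePreserving (⟨T.1, T.2.1.measurable, T.2.2.1⟩ : X ≃ᵐ X) μ μ := T.2.1
  rw [← map_inv, ← map_mul, FullGroup.length_mk, measureReal_def, measureReal_def]
  congr 1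
  rw [← hT.measure_preimage_equiv]
  congr 1
  ext x
  simp

/-- The metric `d(g, h) = ℓ(g h⁻¹)` on the full group. -/
instance [IsProbabilityMeasure μ] : MetricSpace (FullGroup μ G) where
  dist g h := (g * h⁻¹).length
  dist_self g := by
    obtain ⟨S, rfl⟩ := FullGroup.mk_surjective g
    rw [FullGroup.length_mul_inv]; simp
  dist_comm g h := by
    obtain ⟨S, rfl⟩ := FullGroup.mk_surjective g
    obtain ⟨T, rfl⟩ := FullGroup.mk_surjective h
    rw [FullGroup.length_mul_inv, FullGroup.length_mul_inv]
    simp only [ne_comm]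
  dist_triangle g h k := by
    obtain ⟨S, rfl⟩ := FullGroup.mk_surjective g
    obtain ⟨T, rfl⟩ := FullGroup.mk_surjective h
    obtain ⟨U, rfl⟩ := FullGroup.mk_surjective k
    simp only [FullGroup.length_mul_inv]
    refine (measureReal_mono ?_).trans (measureReal_union_le _ _)
    intro x hx
    by_contra hc
    simp only [Set.mem_union, Set.mem_ofPred_eq, not_or, not_not] at hc
    exact hx (hc.1.trans hc.2)
  eq_of_dist_eq_zero := by
    intro g h hgh
    obtain ⟨S, rfl⟩ := FullGroup.mk_surjective g
    obtain ⟨T, rfl⟩ := FullGroup.mk_surjective h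
    change (FullGroup.mk S * (FullGroup.mk T)⁻¹).length = 0 at hgh
    rw [FullGroup.length_mul_inv, measureReal_eq_zero_iff] at hgh
    exact FullGroup.mk_eq_mk.2 hgh

/-! ### The von Neumann algebra of the relation -/

/-- The counting measure on the pairs `(x, y)` with `x` in the orbit of `y`. -/
def fiberCount (G : Subgroup (Equiv.Perm X)) (y : X) : Measure (X × X) :=
  Measure.sum fun x : MulAction.orbit G y => Measure.dirac ((x : X), y)

/-- The measure `ν(E) = ∫ #{x | (x, y) ∈ E, x in the orbit of y} dμ(y)` on `X × X`; it lives on the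
orbit equivalence relation. -/
def orbitMeasure (μ : Measure X) (G : Subgroup (Equiv.Perm X)) : Measure (X × X) :=
  μ.bind (fiberCount G)

theorem fiberCount_apply (y : X) {E : Set (X × X)} (hE : MeasurableSet E) :
    fiberCount G y E = ∑' x : MulAction.orbit G y, E.indicator 1 ((x : X), y) := by
  rw [fiberCount, Measure.sum_apply _ hE]
  exact tsum_congr fun x => Measure.dirac_apply' _ hE

theorem measurable_fiberCount [StandardBorelSpace X] [hG : IsPMP μ G] :
    Measurable (fiberCount G) := by
  have := hG.countable
  obtain ⟨e, he⟩ := exists_injective_nat G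
  have hm : ∀ g : G, Measurable fun y => g • y := fun g => (hG.measurePreserving g.1 g.2).measurable
  refine Measure.measurable_of_measurable_coe _ fun E hE => ?_
  let A : G → Set X := fun g => {y | ∀ h : G, e h < e g → h • y ≠ g • y}
  have hA : ∀ g, MeasurableSet (A g) := by
    intro g
    have : A g = ⋂ h : G, ⋂ _ : e h < e g, {y | h • y = g • y}ᶜ := by
      ext y; simp [A]
    rw [this]
    exact MeasurableSet.iInter fun h => MeasurableSet.iInter fun _ =>
      (measurableSet_eq_fun (hm h) (hm g)).compl
  have key : ∀ y, fiberCount G y E =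
      ∑' g : G, (A g).indicator (fun y => E.indicator (1 : X × X → ℝ≥0∞) (g • y, y)) y := by
    intro y
    rw [fiberCount_apply y hE]
    let f : {g : G // y ∈ A g} → MulAction.orbit G y := fun g => ⟨g.1 • y, g.1, rfl⟩
    have hf : Function.Bijective f := by
      constructor
      · rintro ⟨g, hg⟩ ⟨h, hh⟩ hgh
        have h1 : g • y = h • y := congrArg Subtype.val hgh
        have : e g = e h := by
          rcases lt_trichotomy (e g) (e h) with h2 | h2 | h2
          · exact absurd h1 (hh g h2)
          · exact h2
          · exact absurd h1.symm (hg h h2)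
        exact Subtype.ext (he this)
      · rintro ⟨x, g, rfl⟩
        classical
        have hex : ∃ n, ∃ h : G, e h = n ∧ h • y = g • y := ⟨_, g, rfl, rfl⟩
        obtain ⟨h, h1, h2⟩ := Nat.find_spec hex
        refine ⟨⟨h, fun k hk hky => ?_⟩, Subtype.ext h2⟩
        rw [h1] at hk
        exact Nat.find_min hex hk ⟨k, rfl, hky.trans h2⟩
    rw [← (Equiv.ofBijective f hf).tsum_eq]
    have h3 := tsum_subtype {g : G | y ∈ A g}
      (fun g => E.indicator (1 : X × X → ℝ≥0∞) (g • y, y))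
    refine Eq.trans h3 (tsum_congr fun g => ?_)
    simp [Set.indicator]
  simp only [key]
  refine Measurable.tsum fun g => Measurable.indicator ?_ (hA g)
  exact (measurable_one.indicator hE).comp ((hm g).prodMk measurable_id)

theorem orbitMeasure_apply [StandardBorelSpace X] [IsPMP μ G] {E : Set (X × X)}
    (hE : MeasurableSet E) : orbitMeasure μ G E =
      ∫⁻ y, ∑' x : MulAction.orbit G y, E.indicator 1 ((x : X), y) ∂μ := by
  rw [orbitMeasure, Measure.bind_apply hE (measurable_fiberCount (μ := μ)).aemeasurable]
  exact lintegral_congr fun y => fiberCount_apply y hE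

/-- For almost every `y`, a property that holds almost everywhere holds on the orbit of `y`. -/
theorem ae_orbit [hG : IsPMP μ G] {P : X → Prop} (hP : ∀ᵐ x ∂μ, P x) :
    ∀ᵐ y ∂μ, ∀ x ∈ MulAction.orbit G y, P x := by
  have := hG.countable
  have h : ∀ᵐ y ∂μ, ∀ g : G, P (g • y) := ae_all_iff.2 fun g =>
    (hG.measurePreserving g.1 g.2).quasiMeasurePreserving.ae hP
  filter_upwards [h] with y hy
  rintro _ ⟨g, rfl⟩
  exact hy g

theorem measurePreserving_left [StandardBorelSpace X] [IsPMP μ G] (T : fullGroupRep μ G) :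
    MeasurePreserving (fun p : X × X => (T.1 p.1, p.2)) (orbitMeasure μ G) (orbitMeasure μ G) := by
  have hm : Measurable fun p : X × X => (T.1 p.1, p.2) :=
    (T.2.1.measurable.comp measurable_fst).prodMk measurable_snd
  refine ⟨hm, Measure.ext fun E hE => ?_⟩
  rw [Measure.map_apply hm hE, orbitMeasure_apply (hm hE), orbitMeasure_apply hE]
  refine lintegral_congr_ae ?_
  filter_upwards [ae_orbit (G := G) T.2.2.2, ae_orbit (G := G) (T⁻¹).2.2.2] with y h1 h2
  have h3 : ∀ x, x ∈ MulAction.orbit G y ↔ T.1 x ∈ MulAction.orbit G y := by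
    intro x
    constructor
    · intro hx
      exact Setoid.trans' (MulAction.orbitRel G X) (h1 x hx) hx
    · intro hx
      have h4 := Setoid.trans' (MulAction.orbitRel G X) (h2 _ hx) hx
      have h5 : (T⁻¹).1 (T.1 x) = x := T.1.symm_apply_apply x
      rw [h5] at h4
      exact h4
  exact (T.1.subtypeEquiv h3).tsum_eq
    (fun x : MulAction.orbit G y => E.indicator (1 : X × X → ℝ≥0∞) ((x : X), y))

/-- The Hilbert space `L²` of the relation. -/
abbrev HilbertSp (μ : Measure X) (G : Subgroup (Equiv.Perm X)) : Type _ :=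
  Lp ℂ 2 (orbitMeasure μ G)

section Algebra

variable [StandardBorelSpace X] [IsPMP μ G]

theorem koopman_apply_ae (T : fullGroupRep μ G) (ξ : HilbertSp μ G) :
    Lp.compMeasurePreserving _ (measurePreserving_left T⁻¹) ξ =ᵐ[orbitMeasure μ G]
      fun p => ξ ((T⁻¹).1 p.1, p.2) :=
  Lp.coeFn_compMeasurePreserving _ _

theorem koopman_comp (S T : fullGroupRep μ G) (ξ : HilbertSp μ G) :
    Lp.compMeasurePreserving _ (measurePreserving_left (S * T)⁻¹) ξ =
      Lp.compMeasurePreserving _ (measurePreserving_left S⁻¹)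
        (Lp.compMeasurePreserving _ (measurePreserving_left T⁻¹) ξ) := by
  rw [← Lp.compMeasurePreserving_comp_apply]
  rfl

theorem koopman_one (ξ : HilbertSp μ G) :
    Lp.compMeasurePreserving _ (measurePreserving_left (1 : fullGroupRep μ G)⁻¹) ξ = ξ := by
  exact Lp.compMeasurePreserving_id_apply ξ

/-- The unitary `(u_T ξ)(x, y) = ξ(T⁻¹ x, y)` of a transformation `T` in the full group. -/
def koopmanIso (T : fullGroupRep μ G) : HilbertSp μ G ≃ₗᵢ[ℂ] HilbertSp μ G :=
  { Lp.compMeasurePreservingₗᵢ ℂ _ (measurePreserving_left T⁻¹) with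
    invFun := fun ξ => Lp.compMeasurePreserving _ (measurePreserving_left T) ξ
    left_inv := fun ξ => by
      have h := koopman_comp T⁻¹ T ξ
      simp only [inv_mul_cancel, inv_inv] at h
      exact h.symm.trans (koopman_one ξ)
    right_inv := fun ξ => by
      have h := koopman_comp T T⁻¹ ξ
      simp only [mul_inv_cancel, inv_inv] at h
      exact h.symm.trans (koopman_one ξ) }

theorem koopmanIso_apply (T : fullGroupRep μ G) (ξ : HilbertSp μ G) :
    koopmanIso T ξ = Lp.compMeasurePreserving _ (measurePreserving_left T⁻¹) ξ := rfl

/-- `T ↦ u_T` as a homomorphism to the unitary group of the Hilbert space. -/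
def koopmanRep : fullGroupRep μ G →* unitary (HilbertSp μ G →L[ℂ] HilbertSp μ G) where
  toFun T := Unitary.linearIsometryEquiv.symm (koopmanIso T)
  map_one' := by
    rw [MulEquiv.symm_apply_eq, map_one]
    ext1 ξ
    exact koopman_one ξ
  map_mul' S T := by
    rw [MulEquiv.symm_apply_eq, map_mul, MulEquiv.apply_symm_apply, MulEquiv.apply_symm_apply]
    ext1 ξ
    exact koopman_comp S T ξ

theorem koopmanRep_apply (T : fullGroupRep μ G) (ξ : HilbertSp μ G) :
    (koopmanRep T : HilbertSp μ G →L[ℂ] HilbertSp μ G) ξ =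
      Lp.compMeasurePreserving _ (measurePreserving_left T⁻¹) ξ := rfl

/-- The generators of the von Neumann algebra: multiplication by bounded measurable functions of the
left coordinate, and the unitaries of the full group. -/
def generators (μ : Measure X) (G : Subgroup (Equiv.Perm X)) [IsPMP μ G] :
    Set (HilbertSp μ G →L[ℂ] HilbertSp μ G) :=
  {A | ∃ f : X → ℂ, Measurable f ∧ (∃ C, ∀ x, ‖f x‖ ≤ C) ∧
      ∀ ξ : HilbertSp μ G, A ξ =ᵐ[orbitMeasure μ G] fun p => f p.1 * ξ p} ∪
    {A | ∃ T : fullGroupRep μ G, A = koopmanRep T}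

/-- The von Neumann algebra of the orbit equivalence relation: the double commutant of the
(self-adjoint) set of generators. -/
def relationAlgebra (μ : Measure X) (G : Subgroup (Equiv.Perm X)) [IsPMP μ G] :
    VonNeumannAlgebra (HilbertSp μ G) where
  toStarSubalgebra := StarSubalgebra.centralizer ℂ
    (StarSubalgebra.centralizer ℂ (generators μ G) :
      Set (HilbertSp μ G →L[ℂ] HilbertSp μ G))
  centralizer_centralizer' := Set.centralizer_centralizer_centralizer _

theorem generators_subset {A : HilbertSp μ G →L[ℂ] HilbertSp μ G} (hA : A ∈ generators μ G) :
    A ∈ relationAlgebra μ G := by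
  change A ∈ StarSubalgebra.centralizer ℂ _
  rw [StarSubalgebra.mem_centralizer_iff]
  intro B hB
  refine ⟨((StarSubalgebra.mem_centralizer_iff ℂ).1 hB A hA).1.symm, ?_⟩
  exact ((StarSubalgebra.mem_centralizer_iff ℂ).1 (star_mem hB) A hA).1.symm

theorem orbitMeasure_diagonal [IsProbabilityMeasure μ] :
    orbitMeasure μ G (Set.diagonal X) = 1 := by
  rw [orbitMeasure_apply measurableSet_diagonal]
  have : ∀ y : X, ∑' x : MulAction.orbit G y,
      (Set.diagonal X).indicator (1 : X × X → ℝ≥0∞) ((x : X), y) = 1 := by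
    intro y
    rw [tsum_eq_single (⟨y, MulAction.mem_orbit_self y⟩ : MulAction.orbit G y)]
    · simp
    · intro x hx
      have h : ((x : X), y) ∉ Set.diagonal X := fun h => hx (Subtype.ext h)
      exact Set.indicator_of_notMem h _
  simp [this]

/-- The trace vector: the indicator function of the diagonal. -/
def traceVector (μ : Measure X) (G : Subgroup (Equiv.Perm X)) [IsPMP μ G]
    [IsProbabilityMeasure μ] : HilbertSp μ G :=
  indicatorConstLp 2 (measurableSet_diagonal (α := X))
    (by rw [orbitMeasure_diagonal]; exact ENNReal.one_ne_top) 1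

theorem koopmanRep_ae_eq {T : fullGroupRep μ G} (hT : ∀ᵐ x ∂μ, T.1 x = x) (ξ : HilbertSp μ G) :
    Lp.compMeasurePreserving _ (measurePreserving_left T⁻¹) ξ = ξ := by
  refine Lp.ext ((koopman_apply_ae T ξ).trans ?_)
  have hm : Measurable (T⁻¹).1 := (T⁻¹).2.1.measurable
  have h1 : ∀ᵐ x ∂μ, (T⁻¹).1 x = x := by
    filter_upwards [hT] with x hx
    exact Equiv.Perm.inv_eq_iff_eq.2 hx.symm
  have hE : MeasurableSet {p : X × X | (T⁻¹).1 p.1 = p.1} :=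
    (measurableSet_eq_fun hm measurable_id).preimage measurable_fst
  have h2 : ∀ᵐ p ∂(orbitMeasure μ G), (T⁻¹).1 p.1 = p.1 := by
    change orbitMeasure μ G {p : X × X | (T⁻¹).1 p.1 = p.1}ᶜ = 0
    rw [orbitMeasure_apply hE.compl, lintegral_eq_zero_iff']
    · filter_upwards [ae_orbit (G := G) h1] with y hy
      refine ENNReal.tsum_eq_zero.2 fun x => ?_
      have h : ((x : X), y) ∉ {p : X × X | (T⁻¹).1 p.1 = p.1}ᶜ := fun h => h (hy x x.2)
      exact Set.indicator_of_notMem h _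
    · have h3 := (Measure.measurable_coe hE.compl).comp (measurable_fiberCount (μ := μ) (G := G))
      refine h3.aemeasurable.congr (ae_of_all _ fun y => ?_)
      exact fiberCount_apply y hE.compl
  filter_upwards [h2] with p hp
  rw [hp]

variable [IsProbabilityMeasure μ]

/-- The canonical trace `τ(a) = ⟪ξ₀, a ξ₀⟫` of the von Neumann algebra. -/
def trace (a : relationAlgebra μ G) : ℂ :=
  inner ℂ (traceVector μ G) ((a : HilbertSp μ G →L[ℂ] HilbertSp μ G) (traceVector μ G))

/-- The norm `‖a‖₂ = τ(a* a) ^ (1/2)`. -/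
def twoNorm (a : relationAlgebra μ G) : ℝ := Real.sqrt (trace (star a * a)).re

theorem twoNorm_eq (a : relationAlgebra μ G) :
    twoNorm a = ‖(a : HilbertSp μ G →L[ℂ] HilbertSp μ G) (traceVector μ G)‖ := by
  have h : trace (star a * a) =
      inner ℂ ((a : HilbertSp μ G →L[ℂ] HilbertSp μ G) (traceVector μ G))
        ((a : HilbertSp μ G →L[ℂ] HilbertSp μ G) (traceVector μ G)) := by
    change inner ℂ (traceVector μ G) ((ContinuousLinearMap.adjoint a.1) (a.1 (traceVector μ G))) = _
    exact ContinuousLinearMap.adjoint_inner_right _ _ _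
  rw [twoNorm, h, inner_self_eq_norm_sq_to_K]
  norm_cast
  exact Real.sqrt_sq (norm_nonneg _)

variable (μ G) in
/-- The unitary group of the von Neumann algebra; it carries the metric of the 2-norm, not that of
the operator norm. -/
def UnitaryGroup : Type _ := unitary (relationAlgebra μ G)

instance : Group (UnitaryGroup μ G) := inferInstanceAs (Group (unitary (relationAlgebra μ G)))

/-- The metric `‖a - b‖₂`. -/
instance : PseudoMetricSpace (UnitaryGroup μ G) where
  dist a b := twoNorm (a.1 - b.1)
  dist_self a := by simp [twoNorm_eq]
  dist_comm a b := by
    rw [twoNorm_eq, twoNorm_eq, ← norm_neg]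
    congr 1
    simp
  dist_triangle a b c := by
    simp only [twoNorm_eq]
    refine le_trans (le_of_eq ?_) (norm_add_le _ _)
    congr 1
    simp

/-- `T ↦ u_T` with values in the unitary group of the von Neumann algebra. -/
def koopmanAux : fullGroupRep μ G →* UnitaryGroup μ G where
  toFun T := ⟨⟨koopmanRep T, generators_subset (Or.inr ⟨T, rfl⟩)⟩,
    Subtype.ext (Unitary.star_mul_self_of_mem (koopmanRep T).2),
    Subtype.ext (Unitary.mul_star_self_of_mem (koopmanRep T).2)⟩
  map_one' := by
    refine Subtype.ext (Subtype.ext ?_)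
    change (koopmanRep (1 : fullGroupRep μ G) : HilbertSp μ G →L[ℂ] HilbertSp μ G) = 1
    rw [map_one]
    rfl
  map_mul' S T := by
    refine Subtype.ext (Subtype.ext ?_)
    change (koopmanRep (S * T) : HilbertSp μ G →L[ℂ] HilbertSp μ G) =
      (koopmanRep S : HilbertSp μ G →L[ℂ] HilbertSp μ G) *
        (koopmanRep T : HilbertSp μ G →L[ℂ] HilbertSp μ G)
    rw [map_mul]
    rfl

theorem koopmanAux_eq_one {T : fullGroupRep μ G} (hT : ∀ᵐ x ∂μ, T.1 x = x) :
    koopmanAux T = 1 := by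
  refine Subtype.ext (Subtype.ext ?_)
  change (koopmanRep T : HilbertSp μ G →L[ℂ] HilbertSp μ G) = 1
  refine ContinuousLinearMap.ext fun ξ => ?_
  exact (koopmanRep_apply T ξ).trans (koopmanRep_ae_eq hT ξ)

/-- The embedding `T ↦ u_T` of the full group in the unitary group of the von Neumann algebra. -/
def koopman : FullGroup μ G →* UnitaryGroup μ G :=
  QuotientGroup.lift (nullPart μ G) koopmanAux fun _ hT => koopmanAux_eq_one hT

theorem koopman_mk (T : fullGroupRep μ G) : koopman (FullGroup.mk T) = koopmanAux T :=
  QuotientGroup.lift_mk' (nullPart μ G) _ T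

/-- The trace of `u_T` is the measure of the set of fixed points of `T`, so `T ↦ u_T` is isometric up
to `‖u_S - u_T‖₂² = 2 d(S, T)`. -/
theorem trace_koopman (T : fullGroupRep μ G) :
    trace (koopman (FullGroup.mk T)).1 = μ.real {x | T.1 x = x} := by
  have hD : MeasurableSet (Set.diagonal X) := measurableSet_diagonal
  have hm : Measurable fun p : X × X => ((T⁻¹).1 p.1, p.2) := (measurePreserving_left T⁻¹).measurable
  have hne : orbitMeasure μ G (Set.diagonal X) ≠ ∞ := by
    rw [orbitMeasure_diagonal]; exact ENNReal.one_ne_top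
  have h : trace (koopman (FullGroup.mk T)).1 =
      inner ℂ (indicatorConstLp 2 hD hne (1 : ℂ) : HilbertSp μ G)
        (Lp.compMeasurePreserving _ (measurePreserving_left T⁻¹)
          (indicatorConstLp 2 hD hne (1 : ℂ))) := by
    rw [koopman_mk]
    rfl
  have hne' : orbitMeasure μ G ((fun p : X × X => ((T⁻¹).1 p.1, p.2)) ⁻¹' Set.diagonal X) ≠ ∞ := by
    rw [(measurePreserving_left T⁻¹).measure_preimage hD.nullMeasurableSet]
    exact hne
  rw [h, Lp.indicatorConstLp_compMeasurePreserving,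
    L2.inner_indicatorConstLp_indicatorConstLp hD (hm hD) hne hne', measureReal_def, measureReal_def]
  have h2 : orbitMeasure μ G (Set.diagonal X ∩ (fun p : X × X => ((T⁻¹).1 p.1, p.2)) ⁻¹'
      Set.diagonal X) = μ {x | T.1 x = x} := by
    have hF : MeasurableSet {x | T.1 x = x} := measurableSet_eq_fun T.2.1.measurable measurable_id
    rw [orbitMeasure_apply (hD.inter (hm hD)), ← lintegral_indicator_one hF]
    refine lintegral_congr fun y => ?_
    rw [tsum_eq_single (⟨y, MulAction.mem_orbit_self y⟩ : MulAction.orbit G y)]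
    · have h3 : (T⁻¹).1 y = y ↔ T.1 y = y := by
        rw [eq_comm (b := y)]
        exact Equiv.Perm.eq_inv_iff_eq
      by_cases h4 : T.1 y = y
      · rw [Set.indicator_of_mem (show y ∈ {x | T.1 x = x} from h4)]
        have h5 : (y, y) ∈ Set.diagonal X ∩ (fun p : X × X => ((T⁻¹).1 p.1, p.2)) ⁻¹'
            Set.diagonal X := ⟨rfl, h3.2 h4⟩
        exact Set.indicator_of_mem h5 _
      · rw [Set.indicator_of_notMem (show y ∉ {x | T.1 x = x} from h4)]
        have h5 : (y, y) ∉ Set.diagonal X ∩ (fun p : X × X => ((T⁻¹).1 p.1, p.2)) ⁻¹'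
            Set.diagonal X := fun h6 => h4 (h3.1 h6.2)
        exact Set.indicator_of_notMem h5 _
    · intro x hx
      have h5 : ((x : X), y) ∉ Set.diagonal X ∩ (fun p : X × X => ((T⁻¹).1 p.1, p.2)) ⁻¹'
            Set.diagonal X := fun h6 => hx (Subtype.ext h6.1)
      exact Set.indicator_of_notMem h5 _
  rw [h2]
  simp

end Algebra

end OrbitEquivalence

namespace TuringMachine

open OrbitEquivalence

/-- A state: the tape and the signal (`false` is the bit `0`, `true` is the bit `1`). -/
abbrev State : Type := (ℤ → Bool) × Bool

/-- The uniform measure on one bit. -/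
def coin : Measure Bool := (2 : ℝ≥0∞)⁻¹ • Measure.count

instance : IsProbabilityMeasure coin := by
  constructor
  rw [coin, Measure.smul_apply, ← Finset.coe_univ, Measure.count_apply_finset]
  simp [ENNReal.inv_mul_cancel]

/-- The product measure, with weight `1/2` for every bit. -/
def stateMeasure : Measure State := (Measure.infinitePi fun _ : ℤ => coin).prod coin

instance : IsProbabilityMeasure stateMeasure := by
  rw [stateMeasure]; infer_instance

/-- The shift of the tape to the left. -/
def shift : Equiv.Perm State where
  toFun p := (fun k => p.1 (k + 1), p.2)
  invFun p := (fun k => p.1 (k - 1), p.2)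
  left_inv p := by simp
  right_inv p := by simp

/-- Change the zeroth entry of the tape. -/
def bitFlip : Equiv.Perm State where
  toFun p := (Function.update p.1 0 (!p.1 0), p.2)
  invFun p := (Function.update p.1 0 (!p.1 0), p.2)
  left_inv p := by simp
  right_inv p := by simp

/-- Change the signal. -/
def signalFlip : Equiv.Perm State where
  toFun p := (p.1, !p.2)
  invFun p := (p.1, !p.2)
  left_inv p := by simp
  right_inv p := by simp

/-- The group `(ℤ/2 ≀ ℤ) × ℤ/2` acting by shifting the tape, changing finitely many entries of the
tape, and changing the signal. -/
def tapeGroup : Subgroup (Equiv.Perm State) := Subgroup.closure {shift, bitFlip, signalFlip}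

/-- If the signal is `0`, shift the tape to the left and set the signal to `1`; if the signal is `1`,
shift the tape to the right and set the signal to `0`. -/
def uPerm : Equiv.Perm State where
  toFun p := (fun k => bif p.2 then p.1 (k - 1) else p.1 (k + 1), !p.2)
  invFun p := (fun k => bif p.2 then p.1 (k - 1) else p.1 (k + 1), !p.2)
  left_inv := by rintro ⟨x, _ | _⟩ <;> simp
  right_inv := by rintro ⟨x, _ | _⟩ <;> simp

/-- The permutation `(0,0) ↦ (0,0)`, `(0,1) ↦ (1,1) ↦ (1,0) ↦ (0,1)` of the pairs
(zeroth entry, signal). -/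
def vLocal : Equiv.Perm (Bool × Bool) where
  toFun
    | (false, false) => (false, false)
    | (false, true) => (true, true)
    | (true, true) => (true, false)
    | (true, false) => (false, true)
  invFun
    | (false, false) => (false, false)
    | (true, true) => (false, true)
    | (true, false) => (true, true)
    | (false, true) => (true, false)
  left_inv := by rintro ⟨_ | _, _ | _⟩ <;> rfl
  right_inv := by rintro ⟨_ | _, _ | _⟩ <;> rfl

/-- Apply `vLocal` to the zeroth entry of the tape and the signal. -/
def vPerm : Equiv.Perm State where
  toFun p := (Function.update p.1 0 (vLocal (p.1 0, p.2)).1, (vLocal (p.1 0, p.2)).2)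
  invFun p := (Function.update p.1 0 (vLocal.symm (p.1 0, p.2)).1, (vLocal.symm (p.1 0, p.2)).2)
  left_inv p := by simp
  right_inv p := by simp

theorem measurePreserving_not : MeasurePreserving (fun b : Bool => !b) coin coin := by
  refine ⟨measurable_of_finite _, ?_⟩
  rw [coin, Measure.map_smul]
  congr 1
  refine Measure.ext_of_singleton fun b => ?_
  rw [Measure.map_apply (measurable_of_finite _) (measurableSet_singleton b)]
  have : (fun b : Bool => !b) ⁻¹' {b} = {!b} := by
    ext c; cases b <;> cases c <;> simp
  rw [this, Measure.count_singleton, Measure.count_singleton]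

theorem map_shift (n : ℤ) : (Measure.infinitePi fun _ : ℤ => coin).map
    (fun x k => x (k + n)) = Measure.infinitePi fun _ : ℤ => coin := by
  have h := Measure.infinitePi_map_piCongrLeft (μ := fun _ : ℤ => coin) (Equiv.addRight (-n))
  convert h using 2
  funext x k
  have h1 := MeasurableEquiv.piCongrLeft_apply_apply (β := fun _ : ℤ => Bool)
    (Equiv.addRight (-n)) x (k + n)
  simpa using h1.symm

theorem map_bitFlip : (Measure.infinitePi fun _ : ℤ => coin).map
    (fun x => Function.update x 0 (!x 0)) = Measure.infinitePi fun _ : ℤ => coin := by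
  have h := Measure.infinitePi_map_pi (μ := fun _ : ℤ => coin)
    (f := fun k b => if k = 0 then !b else b) (fun k => measurable_of_finite _)
  have h1 : (fun x : ℤ → Bool => Function.update x 0 (!x 0)) =
      fun x k => if k = 0 then !x k else x k := by
    funext x k
    by_cases hk : k = 0
    · subst hk; simp
    · simp [hk]
  have h2 : (fun k : ℤ => coin.map fun b => if k = 0 then !b else b) = fun _ => coin := by
    funext k
    by_cases hk : k = 0
    · simpa [hk] using measurePreserving_not.map_eq
    · simp [hk]
  rw [h1, h, h2]

theorem measurable_bitFlip :
    Measurable fun x : ℤ → Bool => Function.update x 0 (!x 0) := by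
  refine measurable_pi_lambda _ fun k => ?_
  by_cases hk : k = 0
  · subst hk
    have h : Measurable fun x : ℤ → Bool => !x 0 :=
      (measurable_of_finite not).comp (measurable_pi_apply (0 : ℤ))
    simpa using h
  · simpa [hk] using measurable_pi_apply k

theorem measurePreserving_shift : MeasurePreserving shift stateMeasure stateMeasure :=
  MeasurePreserving.prod ⟨by fun_prop, map_shift 1⟩ (MeasurePreserving.id coin)

theorem measurePreserving_bitFlip : MeasurePreserving bitFlip stateMeasure stateMeasure :=
  MeasurePreserving.prod ⟨measurable_bitFlip, map_bitFlip⟩ (MeasurePreserving.id coin)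

theorem measurePreserving_signalFlip :
    MeasurePreserving signalFlip stateMeasure stateMeasure :=
  MeasurePreserving.prod (MeasurePreserving.id _) measurePreserving_not

/-- The bimeasurable bijections of the state space that preserve the measure. -/
def pmpGroup : Subgroup (Equiv.Perm State) where
  carrier := {T | MeasurePreserving T stateMeasure stateMeasure ∧ Measurable T.symm}
  mul_mem' hS hT := ⟨hS.1.comp hT.1, hT.2.comp hS.2⟩
  one_mem' := ⟨MeasurePreserving.id _, measurable_id⟩
  inv_mem' {T} hT :=
    ⟨MeasurePreserving.symm (⟨T, hT.1.measurable, hT.2⟩ : State ≃ᵐ State) hT.1, hT.1.measurable⟩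

theorem tapeGroup_le : tapeGroup ≤ pmpGroup := by
  rw [tapeGroup, Subgroup.closure_le]
  rintro T (rfl | rfl | rfl)
  · refine ⟨measurePreserving_shift, ?_⟩
    change Measurable fun p : State => ((fun k => p.1 (k - 1), p.2) : State)
    fun_prop
  · exact ⟨measurePreserving_bitFlip, measurePreserving_bitFlip.measurable⟩
  · exact ⟨measurePreserving_signalFlip, measurePreserving_signalFlip.measurable⟩

instance : IsPMP stateMeasure tapeGroup where
  countable := by
    rw [tapeGroup, FreeGroup.closure_eq_range]
    exact (FreeGroup.lift _).rangeRestrict_surjective.countable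
  measurePreserving g hg := (tapeGroup_le hg).1

theorem shift_mem : shift ∈ tapeGroup := Subgroup.subset_closure (by simp)

theorem bitFlip_mem : bitFlip ∈ tapeGroup := Subgroup.subset_closure (by simp)

theorem signalFlip_mem : signalFlip ∈ tapeGroup := Subgroup.subset_closure (by simp)

theorem orbit_of_mem {g : Equiv.Perm State} (hg : g ∈ tapeGroup) {x y : State} (h : g x = y) :
    MulAction.orbitRel tapeGroup State y x := ⟨⟨g, hg⟩, h⟩

/-- Transformations of the tape that depend on the signal. -/
theorem measurePreserving_tape {g : Bool → (ℤ → Bool) → (ℤ → Bool)}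
    (hg : ∀ b, MeasurePreserving (g b) (Measure.infinitePi fun _ : ℤ => coin)
      (Measure.infinitePi fun _ : ℤ => coin)) :
    MeasurePreserving (fun p : State => ((g p.2 p.1, p.2) : State)) stateMeasure stateMeasure := by
  have h := (MeasurePreserving.id coin).skew_product (g := g)
    (measurable_from_prod_countable_right fun b => (hg b).measurable)
    (ae_of_all _ fun b => (hg b).map_eq)
  have h1 : MeasurePreserving (Prod.swap : State → Bool × (ℤ → Bool)) stateMeasure
    (coin.prod (Measure.infinitePi fun _ : ℤ => coin)) := Measure.measurePreserving_swap
  have h2 : MeasurePreserving (Prod.swap : Bool × (ℤ → Bool) → State)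
    (coin.prod (Measure.infinitePi fun _ : ℤ => coin)) stateMeasure :=
    Measure.measurePreserving_swap
  exact h2.comp (h.comp h1)

theorem measurePreserving_uPerm : MeasurePreserving uPerm stateMeasure stateMeasure := by
  have h := measurePreserving_signalFlip.comp (measurePreserving_tape
    (g := fun b x k => bif b then x (k - 1) else x (k + 1)) (by
      rintro (_ | _)
      · exact ⟨by simp only [cond_false]; fun_prop, map_shift 1⟩
      · exact ⟨by simp only [cond_true]; fun_prop, map_shift (-1)⟩))
  exact h

theorem measurePreserving_xor : MeasurePreserving
    (fun p : State => ((p.1, bif p.1 0 then !p.2 else p.2) : State)) stateMeasure stateMeasure := by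
  refine (MeasurePreserving.id (Measure.infinitePi fun _ : ℤ => coin)).skew_product
    (g := fun x b => bif x 0 then !b else b) ?_ (ae_of_all _ fun x => ?_)
  · have h : Measurable fun q : Bool × Bool => bif q.1 then !q.2 else q.2 :=
      measurable_of_finite _
    have h1 : Measurable fun p : State => (p.1 0, p.2) :=
      ((measurable_pi_apply (0 : ℤ)).comp measurable_fst).prodMk measurable_snd
    exact h.comp h1
  · cases x 0
    · exact (MeasurePreserving.id coin).map_eq
    · exact measurePreserving_not.map_eq

theorem measurePreserving_vPerm : MeasurePreserving vPerm stateMeasure stateMeasure := by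
  have h := (measurePreserving_tape
    (g := fun b x => bif b then Function.update x 0 (!x 0) else x) (by
      rintro (_ | _)
      · exact MeasurePreserving.id _
      · exact ⟨measurable_bitFlip, map_bitFlip⟩)).comp measurePreserving_xor
  convert h using 1
  funext ⟨x, S⟩
  have hx : Function.update x 0 (x 0) = x := Function.update_eq_self 0 x
  cases h0 : x 0 <;> cases S <;> rw [h0] at hx <;> simp [vPerm, vLocal, h0, hx]

theorem uPerm_sq : uPerm * uPerm = 1 := by
  ext1 p
  exact uPerm.left_inv p

theorem vPerm_cube : vPerm * vPerm * vPerm = 1 := by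
  ext1 ⟨x, S⟩
  have hx : Function.update x 0 (x 0) = x := Function.update_eq_self 0 x
  cases h0 : x 0 <;> cases S <;> rw [h0] at hx <;> simp [vPerm, vLocal, h0, hx]

theorem uPerm_mem : uPerm ∈ fullGroupRep stateMeasure tapeGroup := by
  refine ⟨measurePreserving_uPerm, measurePreserving_uPerm.measurable, ae_of_all _ ?_⟩
  rintro ⟨x, _ | _⟩
  · exact orbit_of_mem (tapeGroup.mul_mem signalFlip_mem shift_mem) rfl
  · exact orbit_of_mem (tapeGroup.mul_mem signalFlip_mem (tapeGroup.inv_mem shift_mem)) rfl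

theorem vPerm_mem : vPerm ∈ fullGroupRep stateMeasure tapeGroup := by
  refine ⟨measurePreserving_vPerm, ?_, ae_of_all _ ?_⟩
  · have h : vPerm.symm = vPerm * vPerm := inv_eq_of_mul_eq_one_left vPerm_cube
    rw [h]
    exact measurePreserving_vPerm.measurable.comp measurePreserving_vPerm.measurable
  · rintro ⟨x, S⟩
    have hx : Function.update x 0 (x 0) = x := Function.update_eq_self 0 x
    cases h0 : x 0 <;> cases S <;> rw [h0] at hx
    · exact orbit_of_mem tapeGroup.one_mem (by simp [vPerm, vLocal, h0, hx])
    · exact orbit_of_mem bitFlip_mem (by simp [vPerm, vLocal, bitFlip, h0])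
    · exact orbit_of_mem (tapeGroup.mul_mem signalFlip_mem bitFlip_mem)
        (by simp [vPerm, vLocal, bitFlip, signalFlip, h0])
    · exact orbit_of_mem signalFlip_mem (by simp [vPerm, vLocal, signalFlip, h0, hx])

/-- The element `u` of the full group. -/
def u : FullGroup stateMeasure tapeGroup := FullGroup.mk ⟨uPerm, uPerm_mem⟩

/-- The element `v` of the full group. -/
def v : FullGroup stateMeasure tapeGroup := FullGroup.mk ⟨vPerm, vPerm_mem⟩

end TuringMachine

end

noncomputable section

namespace TuringMachine

open OrbitEquivalence

/-! ### The measure and the orbits -/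

/-! Two states are equivalent exactly when their tapes agree off a finite set after a shift
(`orbitRel_iff`). Ergodicity is then Kolmogorov's zero-one law. For hyperfiniteness, cut the tape at
its runs of more than `n` ones and allow moves and changes only inside the interval around the head
that contains no such run; almost surely this interval is finite, and it exhausts the tape as `n`
grows.

The modular group is the free product of cyclic groups of orders 2 and 3, by ping-pong on the two
halves of the upper half plane. The permutations `uPerm` and `vPerm` play ping-pong on `ascending`
and `descending`. These sets are null, but the permutations are homeomorphisms and the measure has
full support, so no element of the generated group is lost modulo null sets.

Non-discreteness comes from the word `w = u v⁻¹ u v⁻¹ u v u v`, which has infinite order although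
almost all its orbits are finite: the supports of the nontrivial elements `w ^ n!` decrease to a
null set (`tendsto_measure_word_pow`). To follow `w`, add a phase in `ZMod 4` and let `step` apply
one factor `u v^{±1}`; signal 0 means that the head has come from the right, signal 1 from the left.
An excursion to the left into a run of `j` ones turns back at the zero beyond it, restores the tape,
and changes the phase by an amount that depends only on the parity of `j` (`HasHeight.returns`).
Signs two phases apart are opposite, hence at even height an entry of the wrong sign closes a cycle.
Otherwise the head moves on to the right, where the first block of four ones must stop it
(`periodic_of_isBlock`). On a run of ones that is infinite to the left the head never turns back,
which gives infinite order (`word_pow_ne_one`).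

Finally `‖u_T - 1‖₂² = 2 μ(supp T)`, so both injectivity and non-discreteness pass to the unitary
group. -/

theorem coin_singleton_ne_zero (b : Bool) : coin {b} ≠ 0 := by
  simp [coin]

theorem coin_ne_zero_of_mem {s : Set Bool} {b : Bool} (hb : b ∈ s) : coin s ≠ 0 := fun h =>
  coin_singleton_ne_zero b (measure_mono_null (Set.singleton_subset_iff.2 hb) h)

/-- A nonempty open set contains a box over finitely many coordinates, whose measure is a finite
product of positive numbers. -/
instance : (Measure.infinitePi fun _ : ℤ => coin).IsOpenPosMeasure where
  open_pos := by
    rintro U hU ⟨x, hx⟩ h0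
    obtain ⟨I, t, ht, hI⟩ := isOpen_pi_iff.1 hU x hx
    have h := measure_mono_null hI h0
    rw [Measure.infinitePi_pi _ (fun i _ => (Set.toFinite (t i)).measurableSet)] at h
    obtain ⟨i, hi, h1⟩ := Finset.prod_eq_zero_iff.1 h
    exact coin_ne_zero_of_mem (ht i hi).2 h1

instance : coin.IsOpenPosMeasure where
  open_pos := by
    rintro U - ⟨b, hb⟩
    exact coin_ne_zero_of_mem hb

instance : stateMeasure.IsOpenPosMeasure := by
  rw [stateMeasure]; infer_instance

theorem shift_zpow_apply (k : ℤ) (p : State) : (shift ^ k) p = (fun j => p.1 (j + k), p.2) := by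
  induction k using Int.induction_on generalizing p with
  | zero => simp
  | succ n ih =>
    rw [zpow_add_one, Equiv.Perm.mul_apply, ih]
    simp [shift, add_assoc]
  | pred n ih =>
    rw [zpow_sub_one, Equiv.Perm.mul_apply, ih]
    change ((fun j => p.1 (j + -(n : ℤ) - 1), p.2) : State) = _
    simp only [add_sub_assoc]

theorem shift_zpow_mem (k : ℤ) : shift ^ k ∈ tapeGroup := tapeGroup.zpow_mem shift_mem k

theorem exists_finite_of_mem {g : Equiv.Perm State} (hg : g ∈ tapeGroup) (p : State) :
    ∃ k : ℤ, {j | (g p).1 j ≠ p.1 (j + k)}.Finite := by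
  rw [tapeGroup] at hg
  induction hg using Subgroup.closure_induction generalizing p with
  | mem g hg =>
    rcases hg with rfl | rfl | rfl
    · exact ⟨1, by simp [shift]⟩
    · refine ⟨0, (Set.finite_singleton 0).subset fun j hj => ?_⟩
      by_contra h
      exact hj (by simp [bitFlip, Function.update_of_ne (show j ≠ 0 from h)])
    · exact ⟨0, by simp [signalFlip]⟩
  | one => exact ⟨0, by simp⟩
  | mul g h _ _ ihg ihh =>
    obtain ⟨k, hk⟩ := ihg (h p)
    obtain ⟨l, hl⟩ := ihh p
    refine ⟨k + l, (hk.union (hl.preimage (add_left_injective k).injOn)).subset fun j hj => ?_⟩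
    by_contra hc
    simp only [Set.mem_union, Set.mem_preimage, Set.mem_ofPred_eq, not_or, not_not] at hc
    exact hj (by rw [Equiv.Perm.mul_apply, hc.1, hc.2, add_assoc])
  | inv g _ ih =>
    obtain ⟨k, hk⟩ := ih (g⁻¹ p)
    refine ⟨-k, (hk.preimage (add_left_injective (-k)).injOn).subset fun j hj => ?_⟩
    simpa [eq_comm] using hj

/-- Change the `k`-th entry of the tape. -/
theorem update_mem_orbit (p : State) (k : ℤ) (b : Bool) :
    MulAction.orbitRel tapeGroup State (Function.update p.1 k b, p.2) p := by
  by_cases hb : b = p.1 k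
  · rw [hb, Function.update_eq_self]
  · refine orbit_of_mem (tapeGroup.mul_mem (tapeGroup.mul_mem (shift_zpow_mem (-k)) bitFlip_mem)
      (shift_zpow_mem k)) ?_
    rw [Equiv.Perm.mul_apply, Equiv.Perm.mul_apply, shift_zpow_apply, shift_zpow_apply]
    refine Prod.ext (funext fun j => ?_) rfl
    have hb' : (!p.1 k) = b := by
      cases b <;> cases h : p.1 k <;> simp_all
    by_cases hj : j = k
    · subst hj
      simp [bitFlip, hb']
    · have : j + -k ≠ 0 := by omega
      simp [bitFlip, hj, this]

/-- The entries are changed one at a time, by induction on a finite set `W` that contains the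
differences; the signal is corrected last. -/
theorem orbitRel_of_finite {p q : State} (h : {j | q.1 j ≠ p.1 j}.Finite) :
    MulAction.orbitRel tapeGroup State q p := by
  obtain ⟨W, hW⟩ : ∃ W : Finset ℤ, ∀ j, q.1 j ≠ p.1 j → j ∈ W :=
    ⟨h.toFinset, fun j hj => by simpa using hj⟩
  induction W using Finset.induction_on generalizing p with
  | empty =>
    have h1 : q.1 = p.1 := funext fun j => by
      by_contra hj
      simpa using hW j hj
    by_cases h2 : q.2 = p.2
    · rw [Prod.ext h1 h2]
    · refine orbit_of_mem signalFlip_mem (Prod.ext h1.symm ?_)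
      change (!p.2) = q.2
      cases h3 : q.2 <;> cases h4 : p.2 <;> simp_all
  | insert a W _ ih =>
    refine Setoid.trans' _ (ih (p := (Function.update p.1 a (q.1 a), p.2)) ?_ ?_)
      (update_mem_orbit p a (q.1 a))
    · refine h.subset fun j hj => ?_
      by_cases hja : j = a
      · subst hja; simp at hj
      · simpa [hja] using hj
    · intro j hj
      by_cases hja : j = a
      · subst hja; simp at hj
      · have := hW j (by simpa [hja] using hj)
        exact (Finset.mem_insert.1 this).resolve_left hja

/-- Two states are in the same orbit when their tapes agree off a finite set up to a shift. -/
theorem orbitRel_iff {p q : State} : MulAction.orbitRel tapeGroup State q p ↔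
    ∃ k : ℤ, {j | q.1 j ≠ p.1 (j + k)}.Finite := by
  constructor
  · rintro ⟨g, rfl⟩
    exact exists_finite_of_mem g.2 p
  · rintro ⟨k, hk⟩
    refine Setoid.trans' _ (orbitRel_of_finite (p := (shift ^ k) p) ?_)
      (orbit_of_mem (shift_zpow_mem k) rfl)
    rwa [shift_zpow_apply]

/-! ### Ergodicity -/

/-- A set of tapes that is invariant under finite changes is null or conull. -/
theorem measure_zero_or_one_of_finite_change {t : Set (ℤ → Bool)} (ht : MeasurableSet t)
    (hinv : ∀ x y : ℤ → Bool, {j | y j ≠ x j}.Finite → x ∈ t → y ∈ t) :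
    (Measure.infinitePi fun _ : ℤ => coin) t = 0 ∨ (Measure.infinitePi fun _ : ℤ => coin) t = 1 := by
  have hind : ProbabilityTheory.iIndepFun (fun (i : ℤ) (ω : ℤ → Bool) => ω i)
      (Measure.infinitePi fun _ : ℤ => coin) :=
    ProbabilityTheory.iIndepFun_infinitePi (X := fun _ b => b) fun _ => measurable_id
  refine ProbabilityTheory.measure_zero_or_one_of_measurableSet_limsup
    (s := fun i : ℤ => MeasurableSpace.comap (fun ω : ℤ → Bool => ω i) inferInstance)
    (f := Filter.cofinite) (p := Set.Finite) (ns := fun F : Finset ℤ => (F : Set ℤ))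
    (fun i => (measurable_pi_apply i).comap_le) hind (fun s hs => hs.compl_mem_cofinite)
    (Monotone.directed_le fun F G h => Finset.coe_subset.2 h) (fun F => F.finite_toSet)
    (fun n => ⟨{n}, by simp⟩) ?_
  classical
  rw [Filter.limsup_eq_iInf_iSup]
  simp only [MeasurableSpace.measurableSet_iInf]
  intro s hs
  -- Resetting the finitely many coordinates outside `s` does not affect membership in `t`, so `t`
  -- is measurable in the coordinates from `s` alone and therefore a tail event.
  let r : (ℤ → Bool) → ℤ → Bool := fun ω i => if i ∈ s then ω i else false
  have hr : Measurable[⨆ i ∈ s, MeasurableSpace.comap (fun ω : ℤ → Bool => ω i) inferInstance] r := by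
    refine @measurable_pi_lambda _ _ _ (_) _ r fun i => ?_
    by_cases hi : i ∈ s
    · simp only [r, if_pos hi]
      exact (comap_measurable _).mono (le_iSup₂_of_le i hi le_rfl) le_rfl
    · simp only [r, if_neg hi]
      exact measurable_const
  have hfin : ∀ ω, {j | r ω j ≠ ω j}.Finite := fun ω =>
    Set.Finite.subset hs fun j hj hjs => hj (if_pos hjs)
  have : t = r ⁻¹' t := by
    ext ω
    refine ⟨hinv _ _ (hfin ω), hinv _ _ ?_⟩
    simpa only [ne_comm] using hfin ω
  rw [this]
  exact hr ht

theorem measure_zero_or_one_of_invariant {s : Set State} (hs : MeasurableSet s)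
    (hinv : ∀ p q, MulAction.orbitRel tapeGroup State q p → p ∈ s → q ∈ s) :
    stateMeasure s = 0 ∨ stateMeasure s = 1 := by
  let t : Set (ℤ → Bool) := (fun x => (x, false)) ⁻¹' s
  have ht : MeasurableSet t := hs.preimage measurable_prodMk_right
  have hst : s = t ×ˢ Set.univ := by
    ext p
    simp only [Set.mem_prod, Set.mem_univ, and_true]
    constructor <;> exact hinv _ _ (orbitRel_of_finite (by simp))
  have h := measure_zero_or_one_of_finite_change ht fun x y hxy hx =>
    hinv _ _ (orbitRel_of_finite hxy) hx
  rwa [hst, stateMeasure, Measure.prod_prod, measure_univ, mul_one]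

instance : SMulInvariantMeasure tapeGroup State stateMeasure where
  measure_preimage_smul g _ hs := (tapeGroup_le g.2).1.measure_preimage hs.nullMeasurableSet

theorem ergodicSMul : ErgodicSMul tapeGroup State stateMeasure where
  aeconst_of_forall_preimage_smul_ae_eq := by
    intro s hs hinv
    have hG : Countable tapeGroup := IsPMP.countable stateMeasure
    -- The zero-one law above needs strict invariance; since the group is countable, intersecting
    -- all translates changes `s` only by a null set.
    let s' : Set State := ⋂ g : tapeGroup, (g • ·) ⁻¹' s
    have hs' : MeasurableSet s' :=
      MeasurableSet.iInter fun g => hs.preimage (tapeGroup_le g.2).1.measurable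
    have hss : s' =ᵐ[stateMeasure] s := by
      have : s' =ᵐ[stateMeasure] ⋂ _ : tapeGroup, s := Filter.EventuallyEq.countable_iInter hinv
      rwa [Set.iInter_const] at this
    have h := measure_zero_or_one_of_invariant hs' (by
      rintro p _ ⟨g, rfl⟩ hp
      refine Set.mem_iInter.2 fun h => ?_
      have := Set.mem_iInter.1 hp (h * g)
      simpa [mul_smul] using this)
    refine Filter.EventuallyConst.congr ?_ hss
    rw [Filter.eventuallyConst_set]
    rcases h with h | h
    · right
      rw [measure_eq_zero_iff_ae_notMem] at h
      exact h.mono fun p hp => by simpa using hp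
    · left
      exact (mem_ae_iff_prob_eq_one hs').2 h

/-! ### Generic tapes -/

/-- The tape `x` has `n` ones from the position `m` on, and then a zero. -/
def IsBlock (x : ℤ → Bool) (n : ℕ) (m : ℤ) : Prop :=
  (∀ j, m ≤ j → j < m + n → x j = true) ∧ x (m + n) = false

theorem IsBlock.congr {x y : ℤ → Bool} {n : ℕ} {m k : ℤ} (h : IsBlock x n m)
    (hxy : ∀ j, m - k ≤ j → j ≤ m - k + n → y j = x (j + k)) : IsBlock y n (m - k) := by
  refine ⟨fun j h1 h2 => ?_, ?_⟩
  · rw [hxy j h1 h2.le]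
    exact h.1 _ (by omega) (by omega)
  · rw [hxy _ (by omega) le_rfl, ← h.2]
    congr 1
    ring

theorem isClopen_isBlock (n : ℕ) : IsClopen {p : State | IsBlock p.1 n 0} := by
  have h : {p : State | IsBlock p.1 n 0} =
      (⋂ j ∈ Finset.Ico (0 : ℤ) n, {p : State | p.1 j = true}) ∩ {p | p.1 n = false} := by
    ext p
    simp [IsBlock]
  rw [h]
  have hc : ∀ (j : ℤ) (b : Bool), IsClopen {p : State | p.1 j = b} := fun j b =>
    (isClopen_discrete {b}).preimage (f := fun p : State => p.1 j)
      ((continuous_apply j).comp continuous_fst)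
  exact (Finset.finite_toSet _).isClopen_biInter (fun j _ => hc j true) |>.inter (hc n false)

theorem measurable_isBlock (n : ℕ) (m : ℤ) : Measurable fun p : State => IsBlock p.1 n m := by
  have h : ∀ (j : ℤ) (b : Bool), Measurable fun p : State => p.1 j = b := fun j b =>
    measurableSet_setOfPred.1 (measurableSet_eq_fun (by fun_prop) measurable_const)
  exact (Measurable.forall fun j => measurable_const.imp (measurable_const.imp (h j true))).and
    (h _ false)

/-- Blocks with `n` ones occur arbitrarily far to the right (`σ = 1`) or to the left (`σ = -1`). -/
def HasBlocks (σ : ℤˣ) (n : ℕ) (p : State) : Prop :=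
  ∀ N : ℤ, ∃ m : ℤ, N ≤ σ * m ∧ IsBlock p.1 n m

theorem exists_abs_bound {W : Set ℤ} (hW : W.Finite) : ∃ B : ℤ, ∀ j ∈ W, |j| ≤ B := by
  obtain ⟨B, hB⟩ := (hW.image fun j => |j|).bddAbove
  exact ⟨B, fun j hj => hB ⟨j, hj, rfl⟩⟩

theorem HasBlocks.of_orbitRel {σ : ℤˣ} {n : ℕ} {p q : State}
    (h : MulAction.orbitRel tapeGroup State q p) (hp : HasBlocks σ n p) : HasBlocks σ n q := by
  obtain ⟨k, hk⟩ := orbitRel_iff.1 h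
  obtain ⟨B, hB⟩ := exists_abs_bound hk
  have hk1 := abs_le.1 (le_refl |k|)
  intro N
  -- So far out that the whole block, after the shift by `k`, lies beyond `N` and beyond every
  -- changed entry.
  obtain ⟨m, hm, hb⟩ := hp (|N| + |k| + |B| + n + 1)
  have hN := abs_le.1 (le_refl |N|)
  have hB' := abs_le.1 (le_refl |B|)
  refine ⟨m - k, ?_, hb.congr fun j h1 h2 => ?_⟩
  · rcases Int.units_eq_one_or σ with rfl | rfl <;>
      simp only [Units.val_one, Units.val_neg] at hm ⊢ <;> omega
  · by_contra hj
    have h3 := abs_le.1 (hB j hj)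
    rcases Int.units_eq_one_or σ with rfl | rfl <;>
      simp only [Units.val_one, Units.val_neg] at hm <;> omega

theorem measurableSet_hasBlocks (σ : ℤˣ) (n : ℕ) : MeasurableSet {p | HasBlocks σ n p} :=
  measurableSet_setOfPred.2 <| Measurable.forall fun _ => Measurable.exists fun m =>
    measurable_const.and (measurable_isBlock n m)

/-- The event is invariant, hence null or conull. It is not null: a block at the head has positive
probability, and by Poincaré recurrence for the shift in direction `σ` almost every state with such
a block sees it again infinitely often. -/
theorem ae_hasBlocks (σ : ℤˣ) (n : ℕ) : ∀ᵐ p ∂stateMeasure, HasBlocks σ n p := by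
  have hinv := measure_zero_or_one_of_invariant (measurableSet_hasBlocks σ n)
    fun p q hpq hp => hp.of_orbitRel hpq
  refine (mem_ae_iff_prob_eq_one (measurableSet_hasBlocks σ n)).2 (hinv.resolve_left fun h0 => ?_)
  have hmp : MeasurePreserving (shift ^ (σ : ℤ)) stateMeasure stateMeasure :=
    (tapeGroup_le (shift_zpow_mem σ)).1
  have hrec := hmp.conservative.ae_mem_imp_frequently_image_mem
    (isClopen_isBlock n).isOpen.measurableSet.nullMeasurableSet
  have hpos : stateMeasure {p : State | IsBlock p.1 n 0} ≠ 0 :=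
    (isClopen_isBlock n).isOpen.measure_ne_zero _
      ⟨(fun j => decide (j < n), false), fun j _ hj => by simpa using hj, by simp⟩
  refine hpos (measure_mono_null_ae ?_ h0)
  filter_upwards [hrec] with p hp hpB N
  obtain ⟨m, hm, hb⟩ := (Filter.frequently_atTop.1 (hp hpB)) N.toNat
  refine ⟨σ * m, ?_, ?_⟩
  · have : (σ : ℤ) * (σ * m) = m := by
      rw [← mul_assoc, Int.units_coe_mul_self, one_mul]
    rw [this]
    omega
  · rw [← Equiv.Perm.coe_pow, ← zpow_natCast, ← zpow_mul, shift_zpow_apply] at hb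
    have := hb.congr (y := p.1) (k := -(σ * m)) fun j _ _ => by simp
    simpa using this

/-- Blocks of every length occur arbitrarily far in both directions. -/
def IsGeneric (p : State) : Prop := ∀ σ n, HasBlocks σ n p

theorem ae_isGeneric : ∀ᵐ p ∂stateMeasure, IsGeneric p :=
  ae_all_iff.2 fun σ => ae_all_iff.2 fun n => ae_hasBlocks σ n

theorem measurable_isGeneric : Measurable IsGeneric :=
  Measurable.forall fun σ => Measurable.forall fun n =>
    measurableSet_setOfPred.1 (measurableSet_hasBlocks σ n)

theorem IsGeneric.of_orbitRel {p q : State} (h : MulAction.orbitRel tapeGroup State q p)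
    (hp : IsGeneric p) : IsGeneric q := fun σ n => (hp σ n).of_orbitRel h

theorem IsGeneric.exists_right {p : State} (hp : IsGeneric p) (n : ℕ) (N : ℤ) :
    ∃ m, N ≤ m ∧ IsBlock p.1 n m := by
  simpa using hp 1 n N

theorem IsGeneric.exists_left {p : State} (hp : IsGeneric p) (n : ℕ) (N : ℤ) :
    ∃ m, m + n ≤ N ∧ IsBlock p.1 n m := by
  obtain ⟨m, hm, hb⟩ := hp (-1) n (n - N)
  exact ⟨m, by simp only [Units.val_neg, Units.val_one] at hm; omega, hb⟩

/-! ### Hyperfiniteness -/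

/-- The position `j` lies in a run of at least `n + 1` ones. -/
def InRun (n : ℕ) (x : ℤ → Bool) (j : ℤ) : Prop :=
  ∃ m, m ≤ j ∧ j ≤ m + n ∧ ∀ i, m ≤ i → i ≤ m + n → x i = true

theorem InRun.anti {n n' : ℕ} (h : n ≤ n') {x : ℤ → Bool} {j : ℤ} (hj : InRun n' x j) :
    InRun n x j := by
  obtain ⟨m, h1, h2, h3⟩ := hj
  -- Shorten the run to its first `n + 1` positions if these contain `j`, and otherwise to the `n +
  -- 1` positions that end at `j`.
  by_cases h4 : j ≤ m + n
  · exact ⟨m, h1, h4, fun i h5 h6 => h3 i h5 (by omega)⟩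
  · exact ⟨j - n, by omega, by omega, fun i h5 h6 => h3 i (by omega) (by omega)⟩

theorem measurable_inRun (n : ℕ) (j : ℤ) : Measurable fun x => InRun n x j :=
  Measurable.exists fun _ => measurable_const.and <| measurable_const.and <| Measurable.forall
    fun i => measurable_const.imp <| measurable_const.imp <|
      measurableSet_setOfPred.1 (measurableSet_eq_fun (measurable_pi_apply i) measurable_const)

/-- No run of at least `n + 1` ones meets the interval between `a` and `b`. -/
def Linked (n : ℕ) (x : ℤ → Bool) (a b : ℤ) : Prop :=
  ∀ i ∈ Set.uIcc a b, ¬InRun n x i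

namespace Linked

variable {n : ℕ} {x y : ℤ → Bool} {a b c k : ℤ}

theorem symm (h : Linked n x a b) : Linked n x b a := fun i hi => h i (Set.uIcc_comm a b ▸ hi)

theorem trans (h : Linked n x a b) (h' : Linked n x b c) : Linked n x a c := fun i hi =>
  (Set.uIcc_subset_uIcc_union_uIcc hi).elim (h i) (h' i)

theorem mono {n' : ℕ} (hn : n ≤ n') (h : Linked n x a b) : Linked n' x a b :=
  fun i hi hr => h i hi (hr.anti hn)

/-- Linkedness depends only on where the long runs are, so it can be transported between tapes with
the same long runs. This is what makes `LinkedTapes` symmetric and transitive. -/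
theorem shift (hU : ∀ j, InRun n y j ↔ InRun n x (j + k)) :
    Linked n y a b ↔ Linked n x (a + k) (b + k) := by
  constructor
  · intro h i hi hr
    refine h (i - k) ?_ ((hU _).2 (by simpa using hr))
    rw [Set.mem_uIcc] at hi ⊢
    omega
  · intro h i hi hr
    refine h (i + k) ?_ ((hU _).1 hr)
    rw [Set.mem_uIcc] at hi ⊢
    omega

end Linked

/-- The tape `y` arises from the tape `x` by moving the head and changing entries within the interval
between the runs of at least `n + 1` ones. -/
def LinkedTapes (n : ℕ) (x y : ℤ → Bool) : Prop :=
  ∃ k : ℤ, (∀ j, InRun n y j ↔ InRun n x (j + k)) ∧ Linked n x 0 k ∧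
    ∀ j, y j ≠ x (j + k) → Linked n y 0 j

namespace LinkedTapes

variable {n : ℕ} {x y z : ℤ → Bool}

theorem symm (h : LinkedTapes n x y) : LinkedTapes n y x := by
  obtain ⟨k, hU, h0, hd⟩ := h
  have hU' : ∀ j, InRun n x j ↔ InRun n y (j + -k) := fun j => by rw [hU]; simp
  refine ⟨-k, hU', ?_, fun j hj => ?_⟩
  · rw [Linked.shift hU]
    simpa using h0.symm
  · have := hd (j + -k) (by simpa using hj.symm)
    rw [Linked.shift hU] at this
    exact h0.trans (by simpa using this)

theorem trans (h : LinkedTapes n x y) (h' : LinkedTapes n y z) : LinkedTapes n x z := by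
  obtain ⟨k, hU, h0, hd⟩ := h
  obtain ⟨l, hU', h0', hd'⟩ := h'
  refine ⟨l + k, fun j => by rw [hU', hU, add_assoc], h0.trans ?_, fun j hj => ?_⟩
  · rw [Linked.shift hU] at h0'
    simpa using h0'
  · by_cases hzy : z j = y (j + l)
    · have := h0'.symm.trans (hd (j + l) (by rwa [← hzy, add_assoc]))
      rw [Linked.shift hU']
      simpa using this
    · exact hd' j hzy

/-- A changed entry is never in a long run of `y`, so the even longer runs of `y` consist of
unchanged entries and are runs of `x` as well. Applied in both directions, this makes the relations
increase with `n`. -/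
theorem inRun_of_le {n' : ℕ} (hn : n ≤ n') {k : ℤ} (hd : ∀ j, y j ≠ x (j + k) → Linked n y 0 j)
    {j : ℤ} (hj : InRun n' y j) : InRun n' x (j + k) := by
  obtain ⟨m, h1, h2, h3⟩ := hj
  refine ⟨m + k, by omega, by omega, fun i hi hi' => ?_⟩
  by_contra hc
  have h4 := h3 (i - k) (by omega) (by omega)
  refine hd (i - k) (by rw [h4]; simpa using Ne.symm hc) (i - k) Set.right_mem_uIcc ?_
  exact InRun.anti hn ⟨m, by omega, by omega, h3⟩

theorem mono {n' : ℕ} (hn : n ≤ n') (h : LinkedTapes n x y) : LinkedTapes n' x y := by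
  obtain ⟨k, hU, h0, hd⟩ := id h
  refine ⟨k, fun j => ⟨inRun_of_le hn hd, fun hj => ?_⟩, h0.mono hn, fun j hj => (hd j hj).mono hn⟩
  have hd' : ∀ j, x j ≠ y (j + -k) → Linked n x 0 j := fun j hj => by
    have := hd (j + -k) (by simpa using hj.symm)
    rw [Linked.shift hU] at this
    exact h0.trans (by simpa using this)
  simpa using inRun_of_le hn hd' hj

end LinkedTapes

theorem finite_setOf_eq_off (z : ℤ → Bool) {W : Set ℤ} (hW : W.Finite) :
    {q : State | ∀ j ∉ W, q.1 j = z j}.Finite := by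
  have := hW.to_subtype
  refine Set.Finite.of_finite_image (f := fun q : State => ((fun j : W => q.1 j), q.2))
    (Set.toFinite _) ?_
  intro p hp q hq hpq
  refine Prod.ext (funext fun j => ?_) (Prod.ext_iff.1 hpq).2
  by_cases hj : j ∈ W
  · exact congrFun (Prod.ext_iff.1 hpq).1 ⟨j, hj⟩
  · rw [hp j hj, hq j hj]

/-- A generic tape has a run of `n + 1` ones on either side of the head, and no linked position lies
beyond these. -/
theorem IsGeneric.exists_linked_subset {p : State} (hp : IsGeneric p) (n : ℕ) :
    ∃ a b : ℤ, ∀ j, Linked n p.1 0 j → j ∈ Set.Ioo a b := by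
  obtain ⟨b, hb, hB⟩ := hp.exists_right (n + 1) 0
  obtain ⟨a, ha, hA⟩ := hp.exists_left (n + 1) 0
  push_cast at ha
  refine ⟨a, b, fun j hj => ⟨?_, ?_⟩⟩ <;> by_contra hc
  · refine hj a ?_ ⟨a, le_rfl, by omega, fun i h1 h2 => hA.1 i h1 (by push_cast; omega)⟩
    rw [Set.mem_uIcc]
    omega
  · refine hj b ?_ ⟨b, le_rfl, by omega, fun i h1 h2 => hB.1 i h1 (by push_cast; omega)⟩
    rw [Set.mem_uIcc]
    omega

/-- A generic tape has zeros on both sides of the window; a run that meets the window stays between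
them, which bounds its length. -/
theorem IsGeneric.exists_forall_not_inRun {p : State} (hp : IsGeneric p) (B : ℤ) :
    ∃ n₀, ∀ n ≥ n₀, ∀ j, |j| ≤ B → ¬InRun n p.1 j := by
  obtain ⟨b, hb, hb'⟩ := hp.exists_right 0 (B + 1)
  obtain ⟨a, ha, ha'⟩ := hp.exists_left 0 (-B - 1)
  have ha0 : p.1 a = false := by simpa using ha'.2
  have hb0 : p.1 b = false := by simpa using hb'.2
  refine ⟨(b - a).toNat, fun n hn j hj => ?_⟩
  rintro ⟨m, h1, h2, h3⟩
  have hj' := abs_le.1 hj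
  by_cases h4 : m ≤ a
  · have := h3 a h4 (by push_cast at ha; omega)
    simp_all
  · have := h3 b (by omega) (by omega)
    simp_all

/-- The finite equivalence relation of the intervals between the runs of at least `n + 1` ones. -/
def finiteRel (n : ℕ) : Setoid State where
  -- Non-generic states form singleton classes, since linked intervals can be infinite there. The
  -- signal is left free, which at most doubles a class.
  r p q := p = q ∨ (IsGeneric p ∧ IsGeneric q ∧ LinkedTapes n p.1 q.1)
  iseqv :=
    { refl := fun p => Or.inl rfl
      symm := by
        rintro p q (h | ⟨hp, hq, h⟩)
        · exact Or.inl h.symm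
        · exact Or.inr ⟨hq, hp, h.symm⟩
      trans := by
        rintro p q r (rfl | ⟨hp, hq, h⟩) (rfl | ⟨hq', hr, h'⟩)
        · exact Or.inl rfl
        · exact Or.inr ⟨hq', hr, h'⟩
        · exact Or.inr ⟨hp, hq, h⟩
        · exact Or.inr ⟨hp, hr, h.trans h'⟩ }

theorem measurableSet_finiteRel (n : ℕ) :
    MeasurableSet {r : State × State | finiteRel n r.1 r.2} := by
  have h1 : ∀ j, Measurable fun r : State × State => InRun n r.1.1 j := fun j =>
    (measurable_inRun n j).comp (measurable_fst.comp measurable_fst)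
  have h2 : ∀ j, Measurable fun r : State × State => InRun n r.2.1 j := fun j =>
    (measurable_inRun n j).comp (measurable_fst.comp measurable_snd)
  have h3 : ∀ j k, Measurable fun r : State × State => r.2.1 j ≠ r.1.1 (j + k) := fun j k =>
    (measurableSet_setOfPred.1 (measurableSet_eq_fun (by fun_prop) (by fun_prop))).not
  refine measurableSet_setOfPred.2 (Measurable.or ?_ (Measurable.and ?_ (Measurable.and ?_ ?_)))
  · exact measurableSet_setOfPred.1 measurableSet_diagonal
  · exact measurable_isGeneric.comp measurable_fst
  · exact measurable_isGeneric.comp measurable_snd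
  · exact Measurable.exists fun k => Measurable.and
      (Measurable.forall fun j => (h2 j).iff (h1 _)) <| Measurable.and
      (Measurable.forall fun i => measurable_const.imp (h1 i).not)
      (Measurable.forall fun j => (h3 j k).imp
        (Measurable.forall fun i => measurable_const.imp (h2 i).not))

/-- The bound on the linked interval of `x` confines both the displacement of the head and the
changed entries, so only finitely many `y` remain. -/
theorem LinkedTapes.exists_eq_off {n : ℕ} {x y : ℤ → Bool} {a b : ℤ}
    (hab : ∀ j, Linked n x 0 j → j ∈ Set.Ioo a b) (h : LinkedTapes n x y) :
    ∃ k ∈ Set.Ioo a b, ∀ j ∉ Set.Ioo (a - k) (b - k), y j = x (j + k) := by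
  obtain ⟨k, hU, h0, hd⟩ := h
  refine ⟨k, hab k h0, fun j hj => ?_⟩
  by_contra hc
  have := hd j hc
  rw [Linked.shift hU, zero_add] at this
  have := hab _ (h0.trans this)
  simp only [Set.mem_Ioo] at this hj
  omega

theorem finite_finiteRel (n : ℕ) (p : State) : {q | finiteRel n p q}.Finite := by
  by_cases hp : IsGeneric p
  · obtain ⟨a, b, hab⟩ := hp.exists_linked_subset n
    refine ((Set.finite_singleton p).union ((Set.finite_Ioo a b).biUnion fun k _ =>
      finite_setOf_eq_off (fun j => p.1 (j + k)) (Set.finite_Ioo (a - k) (b - k)))).subset ?_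
    rintro q (rfl | ⟨-, -, h⟩)
    · exact Or.inl rfl
    · obtain ⟨k, hk, h1⟩ := h.exists_eq_off hab
      exact Or.inr (Set.mem_biUnion hk h1)
  · refine (Set.finite_singleton p).subset ?_
    rintro q (rfl | ⟨h, -⟩)
    · rfl
    · exact absurd h hp

/-- Take `n` so large that no long run of either tape meets a window that contains the head, its
displacement and all changed entries. Then the long runs of the two tapes correspond. -/
theorem exists_finiteRel {p q : State} (hp : IsGeneric p)
    (h : MulAction.orbitRel tapeGroup State q p) : ∃ n, finiteRel n p q := by
  have hq := hp.of_orbitRel h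
  obtain ⟨k, hk⟩ := orbitRel_iff.1 h
  obtain ⟨B, hB⟩ := exists_abs_bound hk
  have hB' : ∀ j, q.1 j ≠ p.1 (j + k) → |j| ≤ B := hB
  obtain ⟨n₁, h₁⟩ := hp.exists_forall_not_inRun (|B| + |k|)
  obtain ⟨n₂, h₂⟩ := hq.exists_forall_not_inRun |B|
  have hr₁ := h₁ _ (le_max_left n₁ n₂)
  have hr₂ := h₂ _ (le_max_right n₁ n₂)
  have hk1 := abs_le.1 (le_refl |k|)
  have hB1 := abs_le.1 (le_refl |B|)
  refine ⟨max n₁ n₂, Or.inr ⟨hp, hq, k, fun j => ⟨?_, ?_⟩, ?_, fun j hj i hi => ?_⟩⟩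
  · rintro ⟨m, h1, h2, h3⟩
    refine ⟨m + k, by omega, by omega, fun i hi hi' => ?_⟩
    by_contra hc
    have h4 := h3 (i - k) (by omega) (by omega)
    have h5 := hB' (i - k) (by rw [h4]; simpa using Ne.symm hc)
    exact hr₂ (i - k) (h5.trans (le_abs_self B)) ⟨m, by omega, by omega, h3⟩
  · rintro ⟨m, h1, h2, h3⟩
    refine ⟨m - k, by omega, by omega, fun i hi hi' => ?_⟩
    by_contra hc
    have h4 := h3 (i + k) (by omega) (by omega)
    have h5 := abs_le.1 (hB' i (by rwa [h4]))
    exact hr₁ (i + k) (abs_le.2 ⟨by omega, by omega⟩) ⟨m, by omega, by omega, h3⟩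
  · intro i hi
    rw [Set.mem_uIcc] at hi
    exact hr₁ i (abs_le.2 ⟨by omega, by omega⟩)
  · have h5 := abs_le.1 (hB' j hj)
    rw [Set.mem_uIcc] at hi
    exact hr₂ i (abs_le.2 ⟨by omega, by omega⟩)

theorem orbitRel_of_finiteRel {n : ℕ} {p q : State} (h : finiteRel n p q) :
    MulAction.orbitRel tapeGroup State p q := by
  rcases h with rfl | ⟨hp, -, h⟩
  · exact Setoid.refl' _ _
  · obtain ⟨a, b, hab⟩ := hp.exists_linked_subset n
    obtain ⟨k, -, h1⟩ := h.exists_eq_off hab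
    refine Setoid.symm' _ (orbitRel_iff.2 ⟨k, (Set.finite_Ioo (a - k) (b - k)).subset fun j hj => ?_⟩)
    by_contra hc
    exact hj (h1 j hc)

theorem isHyperfinite : IsHyperfinite stateMeasure tapeGroup := by
  refine ⟨finiteRel, measurableSet_finiteRel, finite_finiteRel, fun n n' hn p q h => ?_, ?_⟩
  · exact h.imp_right fun ⟨hp, hq, h⟩ => ⟨hp, hq, h.mono hn⟩
  · filter_upwards [ae_isGeneric] with p hp q
    exact ⟨fun h => exists_finiteRel hp (Setoid.symm' _ h), fun ⟨n, h⟩ => orbitRel_of_finiteRel h⟩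

end TuringMachine

/-! ### The free product of cyclic groups of orders `2` and `3` -/

namespace FreeProductTwoThree

/-- The orders of the two factors. -/
@[reducible] def factorOrder : Bool → ℕ
  | false => 2
  | true => 3

/-- The free product of the cyclic groups of orders `2` and `3`. -/
abbrev FreeProduct : Type := Monoid.CoprodI fun i : Bool => Multiplicative (ZMod (factorOrder i))

/-- The generator of order `2`. -/
def genTwo : FreeProduct :=
  Monoid.CoprodI.of (i := false) (Multiplicative.ofAdd (1 : ZMod 2))

/-- The generator of order `3`. -/
def genThree : FreeProduct :=
  Monoid.CoprodI.of (i := true) (Multiplicative.ofAdd (1 : ZMod 3))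

variable {K L : Type*} [Group K] [Group L]

/-- The homomorphism from the cyclic group of order `n` given by an element with `a ^ n = 1`. -/
def zmodHom (n : ℕ) (a : K) (ha : a ^ n = 1) : Multiplicative (ZMod n) →* K :=
  AddMonoidHom.toMultiplicativeLeft
    (ZMod.lift n ⟨zmultiplesHom (Additive K) (Additive.ofMul a), by
      rw [zmultiplesHom_apply, natCast_zsmul]
      exact congrArg Additive.ofMul ha⟩)

theorem zmodHom_natCast (n : ℕ) (a : K) (ha : a ^ n = 1) (k : ℕ) :
    zmodHom n a ha (Multiplicative.ofAdd (k : ZMod n)) = a ^ k := by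
  have h := ZMod.lift_coe n ⟨zmultiplesHom (Additive K) (Additive.ofMul a), by
      rw [zmultiplesHom_apply, natCast_zsmul]
      exact congrArg Additive.ofMul ha⟩ (k : ℤ)
  rw [Int.cast_natCast] at h
  have h' := congrArg Additive.toMul h
  exact (show zmodHom n a ha _ = _ from h').trans (by simp)

theorem zmodHom_one (n : ℕ) (a : K) (ha : a ^ n = 1) :
    zmodHom n a ha (Multiplicative.ofAdd 1) = a := by
  simpa using zmodHom_natCast n a ha 1

theorem zmodHom_range_le (n : ℕ) [NeZero n] (a : K) (ha : a ^ n = 1) {s : Subgroup K} (h : a ∈ s) :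
    (zmodHom n a ha).range ≤ s := by
  rintro _ ⟨x, rfl⟩
  have := zmodHom_natCast n a ha (ZMod.val x.toAdd)
  rw [ZMod.natCast_zmod_val] at this
  change zmodHom n a ha (Multiplicative.ofAdd x.toAdd) ∈ s
  rw [this]
  exact s.pow_mem h _

/-- The homomorphism on each of the two factors. -/
def factorHom (a b : K) (ha : a ^ 2 = 1) (hb : b ^ 3 = 1) :
    ∀ i : Bool, Multiplicative (ZMod (factorOrder i)) →* K
  | false => zmodHom 2 a ha
  | true => zmodHom 3 b hb

/-- The homomorphism from the free product given by elements with `a ^ 2 = 1` and `b ^ 3 = 1`. -/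
def lift (a b : K) (ha : a ^ 2 = 1) (hb : b ^ 3 = 1) : FreeProduct →* K :=
  Monoid.CoprodI.lift (factorHom a b ha hb)

section

variable (a b : K) (ha : a ^ 2 = 1) (hb : b ^ 3 = 1)

theorem lift_genTwo : lift a b ha hb genTwo = a := by
  rw [lift, genTwo, Monoid.CoprodI.lift_of]
  exact zmodHom_one 2 a ha

theorem lift_genThree : lift a b ha hb genThree = b := by
  rw [lift, genThree, Monoid.CoprodI.lift_of]
  exact zmodHom_one 3 b hb

theorem lift_range_le {s : Subgroup K} (has : a ∈ s) (hbs : b ∈ s) :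
    (lift a b ha hb).range ≤ s := by
  refine Monoid.CoprodI.lift_range_le _ _ ?_
  rintro (_ | _)
  · exact zmodHom_range_le 2 a ha has
  · exact zmodHom_range_le 3 b hb hbs

theorem lift_range : (lift a b ha hb).range = Subgroup.closure {a, b} := by
  refine le_antisymm (lift_range_le a b ha hb (Subgroup.subset_closure (by simp))
    (Subgroup.subset_closure (by simp))) ((Subgroup.closure_le _).2 ?_)
  rintro x (rfl | rfl)
  · exact ⟨genTwo, lift_genTwo _ _ ha hb⟩
  · exact ⟨genThree, lift_genThree _ _ ha hb⟩

end

/-- The endomorphism that `lift` assigns to the two generators is the identity on each factor, so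
its range is everything. -/
theorem closure_gen : Subgroup.closure {genTwo, genThree} = (⊤ : Subgroup FreeProduct) := by
  have h2 : genTwo ^ 2 = 1 := by
    rw [genTwo, ← map_pow]
    exact map_one _
  have h3 : genThree ^ 3 = 1 := by
    rw [genThree, ← map_pow]
    exact map_one _
  have h : lift genTwo genThree h2 h3 = MonoidHom.id _ := by
    refine Monoid.CoprodI.ext_hom _ _ ?_
    rintro (_ | _) <;> refine MonoidHom.ext fun x => ?_
    · rw [MonoidHom.comp_apply, lift, Monoid.CoprodI.lift_of]
      change zmodHom 2 genTwo h2 (Multiplicative.ofAdd x.toAdd) = _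
      rw [← ZMod.natCast_zmod_val x.toAdd, zmodHom_natCast, genTwo, ← map_pow, ← ofAdd_nsmul]
      congr 2
      simp
    · rw [MonoidHom.comp_apply, lift, Monoid.CoprodI.lift_of]
      change zmodHom 3 genThree h3 (Multiplicative.ofAdd x.toAdd) = _
      rw [← ZMod.natCast_zmod_val x.toAdd, zmodHom_natCast, genThree, ← map_pow, ← ofAdd_nsmul]
      congr 2
      simp
  rw [← lift_range genTwo genThree h2 h3, h]
  exact MonoidHom.range_eq_top.2 Function.surjective_id

theorem hom_ext {f g : FreeProduct →* K} (h2 : f genTwo = g genTwo)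
    (h3 : f genThree = g genThree) : f = g := by
  refine MonoidHom.eq_of_eqOn_dense closure_gen ?_
  rintro x (rfl | rfl) <;> assumption

theorem comp_lift (f : K →* L) (a b : K) (ha : a ^ 2 = 1) (hb : b ^ 3 = 1) :
    f.comp (lift a b ha hb) = lift (f a) (f b) (by rw [← map_pow, ha, map_one])
      (by rw [← map_pow, hb, map_one]) :=
  hom_ext (by simp only [MonoidHom.comp_apply, lift_genTwo])
    (by simp only [MonoidHom.comp_apply, lift_genThree])

/-- Two permutations with `a ^ 2 = 1` and `b ^ 3 = 1` that play ping-pong generate a free product. -/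
theorem lift_injective_of_ping_pong {α : Type*} {a b : Equiv.Perm α} (ha : a ^ 2 = 1)
    (hb : b ^ 3 = 1) {A B : Set α} (hA : A.Nonempty) (hB : B.Nonempty) (hAB : Disjoint A B)
    (haB : ∀ x ∈ B, a x ∈ A) (hbA : ∀ x ∈ A, b x ∈ B) (hbA' : ∀ x ∈ A, b (b x) ∈ B) :
    Function.Injective (lift a b ha hb) := by
  -- With only two factors, ping-pong needs one of them to have at least three elements; here it is
  -- the cyclic group of order 3.
  refine Monoid.CoprodI.lift_injective_of_ping_pong (factorHom a b ha hb) (Or.inr ⟨true, ?_⟩)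
    (fun i => bif i then B else A) ?_ ?_ ?_
  · rw [Cardinal.mk_fintype]
    norm_num
  · rintro (_ | _)
    · exact hA
    · exact hB
  · rintro (_ | _) (_ | _) h
    · exact absurd rfl h
    · exact hAB
    · exact hAB.symm
    · exact absurd rfl h
  · rintro (_ | _) (_ | _) h g hg
    · exact absurd rfl h
    · rintro _ ⟨x, hx, rfl⟩
      obtain rfl : g = Multiplicative.ofAdd (1 : ZMod 2) := by
        revert g; decide
      change zmodHom 2 a ha _ x ∈ A
      rw [zmodHom_one]
      exact haB x hx
    · rintro _ ⟨x, hx, rfl⟩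
      obtain rfl | rfl : g = Multiplicative.ofAdd ((1 : ℕ) : ZMod 3) ∨
          g = Multiplicative.ofAdd ((2 : ℕ) : ZMod 3) := by
        revert g; decide
      · change zmodHom 3 b hb _ x ∈ B
        rw [zmodHom_natCast, pow_one]
        exact hbA x hx
      · change zmodHom 3 b hb _ x ∈ B
        rw [zmodHom_natCast, pow_two]
        exact hbA' x hx
    · exact absurd rfl h

/-! ### The modular group -/

/-- The action of the modular group on the upper half plane. -/
def pslPerm : PSL(2, ℤ) →* Equiv.Perm UpperHalfPlane :=
  QuotientGroup.lift _ (MulAction.toPermHom SL(2, ℤ) UpperHalfPlane) fun g hg => by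
    obtain ⟨r, hr, hg⟩ := Matrix.SpecialLinearGroup.mem_center_iff.1 hg
    -- A central matrix is scalar, and the scalar squares to 1.
    have h : g = 1 ∨ g = -1 := by
      rw [Fintype.card_fin, sq_eq_one_iff] at hr
      rcases hr with rfl | rfl
      · left
        exact Subtype.ext (by rw [← hg]; simp)
      · right
        exact Subtype.ext (by rw [← hg]; simp)
    refine Equiv.ext fun z => ?_
    rcases h with rfl | rfl
    · exact one_smul SL(2, ℤ) z
    · exact (ModularGroup.SL_neg_smul 1 z).trans (one_smul SL(2, ℤ) z)

/-- The class of the matrix `S` in the modular group. -/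
def pslTwo : PSL(2, ℤ) := ((ModularGroup.S : SL(2, ℤ)) : PSL(2, ℤ))

/-- The class of the matrix `S * T` in the modular group. -/
def pslThree : PSL(2, ℤ) := ((ModularGroup.S * ModularGroup.T : SL(2, ℤ)) : PSL(2, ℤ))

theorem neg_one_mem_center : (-1 : SL(2, ℤ)) ∈ Subgroup.center SL(2, ℤ) :=
  Subgroup.mem_center_iff.2 fun g => by simp

theorem pslTwo_pow : pslTwo ^ 2 = 1 := by
  rw [pslTwo, ← QuotientGroup.mk_pow, QuotientGroup.eq_one_iff]
  have : ModularGroup.S ^ 2 = (-1 : SL(2, ℤ)) := by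
    rw [pow_two]; decide
  rw [this]
  exact neg_one_mem_center

theorem pslThree_pow : pslThree ^ 3 = 1 := by
  rw [pslThree, ← QuotientGroup.mk_pow, QuotientGroup.eq_one_iff]
  have : (ModularGroup.S * ModularGroup.T) ^ 3 = (-1 : SL(2, ℤ)) := by
    rw [pow_succ, pow_two]; decide
  rw [this]
  exact neg_one_mem_center

theorem re_S_smul (z : UpperHalfPlane) :
    (ModularGroup.S • z).re = -z.re / Complex.normSq z := by
  rw [UpperHalfPlane.modular_S_smul]
  change ((-(z : ℂ))⁻¹).re = _
  rw [Complex.inv_re, Complex.normSq_neg]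
  rfl

theorem re_T_smul (z : UpperHalfPlane) : (ModularGroup.T • z).re = 1 + z.re := by
  rw [UpperHalfPlane.modular_T_smul]
  simp

theorem normSq_pos (z : UpperHalfPlane) : 0 < Complex.normSq z :=
  Complex.normSq_pos.2 z.ne_zero

theorem pslPerm_two (z : UpperHalfPlane) : pslPerm pslTwo z = ModularGroup.S • z := rfl

theorem pslPerm_three (z : UpperHalfPlane) :
    pslPerm pslThree z = ModularGroup.S • ModularGroup.T • z :=
  mul_smul ModularGroup.S ModularGroup.T z

/-- Ping-pong on the upper half plane with the sign of the real part: `S` takes negative real parts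
to positive ones, while `S T` and its square take positive real parts to negative ones. -/
theorem pslLift_injective :
    Function.Injective (lift pslTwo pslThree pslTwo_pow pslThree_pow) := by
  have h := comp_lift pslPerm pslTwo pslThree pslTwo_pow pslThree_pow
  refine Function.Injective.of_comp (f := pslPerm) ?_
  rw [← MonoidHom.coe_comp, h]
  have hneg : ∀ z : UpperHalfPlane, -1 < z.re → (pslPerm pslThree z).re < 0 := by
    intro z hz
    rw [pslPerm_three, re_S_smul, re_T_smul]
    exact div_neg_of_neg_of_pos (by linarith) (normSq_pos _)
  refine lift_injective_of_ping_pong (A := {z | 0 < z.re}) (B := {z | z.re < 0}) _ _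
    ⟨⟨⟨1, 1⟩, one_pos⟩, ?_⟩ ⟨⟨⟨-1, 1⟩, one_pos⟩, ?_⟩ ?_ ?_ ?_ ?_
  · exact one_pos (α := ℝ)
  · exact neg_one_lt_zero (R := ℝ)
  · exact Set.disjoint_left.2 fun z (h1 : 0 < z.re) (h2 : z.re < 0) => lt_asymm h1 h2
  · intro z hz
    change 0 < (pslPerm pslTwo z).re
    rw [pslPerm_two, re_S_smul]
    exact div_pos (neg_pos.2 hz) (normSq_pos z)
  · intro z hz
    exact hneg z (lt_trans (by norm_num) hz)
  · intro z hz
    refine hneg _ ?_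
    have hz : 0 < z.re := hz
    rw [pslPerm_three, re_S_smul, re_T_smul, lt_div_iff₀ (normSq_pos _)]
    have h1 : Complex.normSq (ModularGroup.T • z : UpperHalfPlane) =
        (1 + z.re) * (1 + z.re) + (ModularGroup.T • z).im * (ModularGroup.T • z).im := by
      rw [← re_T_smul, Complex.normSq_apply]
      rfl
    rw [h1]
    -- With `t = 1 + Re z > 1`, the claim is `t < t² + (Im (T z))²`.
    nlinarith [mul_self_nonneg (ModularGroup.T • z).im]

theorem pslLift_surjective :
    Function.Surjective (lift pslTwo pslThree pslTwo_pow pslThree_pow) := by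
  rw [← MonoidHom.range_eq_top, lift_range]
  have h : Subgroup.closure {ModularGroup.S, ModularGroup.S * ModularGroup.T} =
      (⊤ : Subgroup SL(2, ℤ)) := by
    rw [eq_top_iff, ← SpecialLinearGroup.SL2Z_generators, Subgroup.closure_le]
    have hS : ModularGroup.S ∈
        Subgroup.closure {ModularGroup.S, ModularGroup.S * ModularGroup.T} :=
      Subgroup.subset_closure (by simp)
    have hST : ModularGroup.S * ModularGroup.T ∈
        Subgroup.closure {ModularGroup.S, ModularGroup.S * ModularGroup.T} :=
      Subgroup.subset_closure (by simp)
    rintro x (rfl | rfl)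
    · exact hS
    · have := Subgroup.mul_mem _ (Subgroup.inv_mem _ hS) hST
      rwa [inv_mul_cancel_left] at this
  have h1 := congrArg (Subgroup.map (QuotientGroup.mk' (Subgroup.center SL(2, ℤ)))) h
  rw [MonoidHom.map_closure, Set.image_pair, Subgroup.map_top_of_surjective _
    (QuotientGroup.mk'_surjective _)] at h1
  exact h1

/-- The modular group is the free product of cyclic groups of orders `2` and `3`. -/
def pslEquiv : FreeProduct ≃* PSL(2, ℤ) :=
  MulEquiv.ofBijective (lift pslTwo pslThree pslTwo_pow pslThree_pow)
    ⟨pslLift_injective, pslLift_surjective⟩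

theorem pslEquiv_symm_two : pslEquiv.symm pslTwo = genTwo :=
  pslEquiv.symm_apply_eq.2 (lift_genTwo _ _ pslTwo_pow pslThree_pow).symm

theorem pslEquiv_symm_three : pslEquiv.symm pslThree = genThree :=
  pslEquiv.symm_apply_eq.2 (lift_genThree _ _ pslTwo_pow pslThree_pow).symm

/-- Elements that satisfy the relations of the modular group and generate a free product generate a
copy of the modular group. -/
theorem exists_psl_hom {a b : K} (ha : a ^ 2 = 1) (hb : b ^ 3 = 1)
    (h : Function.Injective (lift a b ha hb)) :
    ∃ φ : PSL(2, ℤ) →* K, Function.Injective φ ∧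
      φ ((ModularGroup.S : SL(2, ℤ)) : PSL(2, ℤ)) = a ∧
      φ ((ModularGroup.S * ModularGroup.T : SL(2, ℤ)) : PSL(2, ℤ)) = b ∧
      φ.range = Subgroup.closure {a, b} := by
  refine ⟨(lift a b ha hb).comp pslEquiv.symm.toMonoidHom, h.comp pslEquiv.symm.injective, ?_, ?_, ?_⟩
  · exact (congrArg _ pslEquiv_symm_two).trans (lift_genTwo a b ha hb)
  · exact (congrArg _ pslEquiv_symm_three).trans (lift_genThree a b ha hb)
  · rw [MonoidHom.range_comp, MonoidHom.range_eq_top.2 pslEquiv.symm.surjective,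
      ← MonoidHom.range_eq_map, lift_range]

end FreeProductTwoThree

namespace TuringMachine

open OrbitEquivalence

/-! ### The free product of `u` and `v` -/

theorem uPerm_pow : uPerm ^ 2 = 1 := by rw [pow_two, uPerm_sq]

theorem vPerm_pow : vPerm ^ 3 = 1 := by rw [pow_succ, pow_two, vPerm_cube]

theorem vPerm_inv : vPerm⁻¹ = vPerm * vPerm := inv_eq_of_mul_eq_one_left vPerm_cube

theorem uPerm_false (x : ℤ → Bool) : uPerm (x, false) = (fun k => x (k + 1), true) := rfl

theorem uPerm_true (x : ℤ → Bool) : uPerm (x, true) = (fun k => x (k - 1), false) := rfl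

theorem vPerm_apply (p : State) : vPerm p =
    (Function.update p.1 0 (vLocal (p.1 0, p.2)).1, (vLocal (p.1 0, p.2)).2) := rfl

theorem vPerm_inv_apply (p : State) : vPerm⁻¹ p =
    (Function.update p.1 0 (vLocal.symm (p.1 0, p.2)).1, (vLocal.symm (p.1 0, p.2)).2) := rfl

/-- The states whose entry at the head and all entries to the left are `1`, with signal `0`. -/
def descending : Set State := {p | (∀ k ≤ 0, p.1 k = true) ∧ p.2 = false}

/-- The states whose entries to the left of the head are `1`, with signal `1`. -/
def ascending : Set State := {p | (∀ k < 0, p.1 k = true) ∧ p.2 = true}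

theorem uPerm_mem_descending {p : State} (hp : p ∈ ascending) : uPerm p ∈ descending := by
  obtain ⟨x, S⟩ := p
  obtain ⟨h, rfl⟩ := hp
  exact ⟨fun k hk => h (k - 1) (by omega), rfl⟩

theorem vPerm_mem_ascending {p : State} (hp : p ∈ descending) : vPerm p ∈ ascending := by
  refine ⟨fun k hk => ?_, ?_⟩
  · rw [vPerm_apply]
    exact (Function.update_of_ne hk.ne _ _).trans (hp.1 k hk.le)
  · rw [vPerm_apply, hp.1 0 le_rfl, hp.2]
    rfl

theorem vPerm_inv_mem_ascending {p : State} (hp : p ∈ descending) : vPerm⁻¹ p ∈ ascending := by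
  refine ⟨fun k hk => ?_, ?_⟩
  · rw [vPerm_inv_apply]
    exact (Function.update_of_ne hk.ne _ _).trans (hp.1 k hk.le)
  · rw [vPerm_inv_apply, hp.1 0 le_rfl, hp.2]
    rfl

/-- Ping-pong takes place on null sets, so freeness is obtained for actual permutations before any
passage to classes. -/
theorem lift_perm_injective :
    Function.Injective (FreeProductTwoThree.lift uPerm vPerm uPerm_pow vPerm_pow) := by
  refine FreeProductTwoThree.lift_injective_of_ping_pong uPerm_pow vPerm_pow
    (A := descending) (B := ascending) ⟨(fun _ => true, false), fun _ _ => rfl, rfl⟩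
    ⟨(fun _ => true, true), fun _ _ => rfl, rfl⟩ ?_ (fun _ => uPerm_mem_descending)
    (fun _ => vPerm_mem_ascending) fun p hp => ?_
  · refine Set.disjoint_left.2 fun p h1 h2 => ?_
    exact Bool.false_ne_true (h1.2.symm.trans h2.2)
  · rw [← Equiv.Perm.mul_apply, ← vPerm_inv]
    exact vPerm_inv_mem_ascending hp

/-! ### Passage from permutations to classes modulo null sets. -/

/-- The permutations of the states that are homeomorphisms. -/
def homeoGroup : Subgroup (Equiv.Perm State) where
  carrier := {T | Continuous T ∧ Continuous T.symm}
  mul_mem' hS hT := ⟨hS.1.comp hT.1, hT.2.comp hS.2⟩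
  one_mem' := ⟨continuous_id, continuous_id⟩
  inv_mem' hT := ⟨hT.2, hT.1⟩

theorem continuous_uPerm : Continuous uPerm := by
  refine Continuous.prodMk (continuous_pi fun k => ?_)
    ((continuous_of_discreteTopology (f := not)).comp continuous_snd)
  have h : Continuous fun q : Bool × Bool × Bool => bif q.1 then q.2.1 else q.2.2 :=
    continuous_of_discreteTopology
  have h1 : ∀ j : ℤ, Continuous fun p : State => p.1 j := fun j =>
    (continuous_apply j).comp continuous_fst
  exact h.comp (continuous_snd.prodMk ((h1 (k - 1)).prodMk (h1 (k + 1))))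

theorem continuous_vPerm : Continuous vPerm := by
  have h : ∀ f : Bool × Bool → Bool, Continuous fun p : State => f (p.1 0, p.2) := fun f =>
    (continuous_of_discreteTopology (f := f)).comp
      (((continuous_apply (0 : ℤ)).comp continuous_fst).prodMk continuous_snd)
  exact (continuous_fst.update 0 (h fun q => (vLocal q).1)).prodMk (h fun q => (vLocal q).2)

theorem uPerm_mem_homeoGroup : uPerm ∈ homeoGroup := ⟨continuous_uPerm, continuous_uPerm⟩

theorem vPerm_mem_homeoGroup : vPerm ∈ homeoGroup := by
  refine ⟨continuous_vPerm, ?_⟩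
  change Continuous ⇑(vPerm⁻¹)
  rw [vPerm_inv]
  exact continuous_vPerm.comp continuous_vPerm

/-- A homeomorphism that is the identity almost everywhere is the identity. -/
theorem eq_one_of_ae_eq {T : Equiv.Perm State} (hT : T ∈ homeoGroup)
    (h : ∀ᵐ p ∂stateMeasure, T p = p) : T = 1 :=
  Equiv.ext fun p => congrFun (Continuous.ae_eq_iff_eq stateMeasure hT.1 continuous_id |>.1 h) p

/-- The representative of `u`. -/
def uRep : fullGroupRep stateMeasure tapeGroup := ⟨uPerm, uPerm_mem⟩

/-- The representative of `v`. -/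
def vRep : fullGroupRep stateMeasure tapeGroup := ⟨vPerm, vPerm_mem⟩

theorem uRep_pow : uRep ^ 2 = 1 := Subtype.ext uPerm_pow

theorem vRep_pow : vRep ^ 3 = 1 := Subtype.ext vPerm_pow

theorem u_pow : u ^ 2 = 1 := by
  change FullGroup.mk uRep ^ 2 = 1
  rw [← map_pow, uRep_pow, map_one]

theorem v_pow : v ^ 3 = 1 := by
  change FullGroup.mk vRep ^ 3 = 1
  rw [← map_pow, vRep_pow, map_one]

theorem lift_rep_injective :
    Function.Injective (FreeProductTwoThree.lift uRep vRep uRep_pow vRep_pow) := by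
  refine Function.Injective.of_comp (f := (fullGroupRep stateMeasure tapeGroup).subtype) ?_
  rw [← MonoidHom.coe_comp, FreeProductTwoThree.comp_lift]
  exact lift_perm_injective

theorem mem_homeoGroup_of_mem_closure {T : fullGroupRep stateMeasure tapeGroup}
    (hT : T ∈ Subgroup.closure {uRep, vRep}) : T.1 ∈ homeoGroup := by
  have h : Subgroup.closure {uRep, vRep} ≤
      homeoGroup.comap (fullGroupRep stateMeasure tapeGroup).subtype := by
    rw [Subgroup.closure_le]
    rintro x (rfl | rfl)
    · exact uPerm_mem_homeoGroup
    · exact vPerm_mem_homeoGroup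
  exact h hT

/-- The group generated by the representatives consists of homeomorphisms, for which equality almost
everywhere is equality. -/
theorem mk_eq_one_of_mem_closure {T : fullGroupRep stateMeasure tapeGroup}
    (hT : T ∈ Subgroup.closure {uRep, vRep}) (h : FullGroup.mk T = 1) : T = 1 :=
  Subtype.ext (eq_one_of_ae_eq (mem_homeoGroup_of_mem_closure hT) (FullGroup.mk_eq_one.1 h))

theorem lift_injective : Function.Injective (FreeProductTwoThree.lift u v u_pow v_pow) := by
  have h := FreeProductTwoThree.comp_lift (FullGroup.mk (μ := stateMeasure) (G := tapeGroup))
    uRep vRep uRep_pow vRep_pow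
  refine (injective_iff_map_eq_one _).2 fun g hg => lift_rep_injective ?_
  rw [map_one]
  refine mk_eq_one_of_mem_closure ?_ ((DFunLike.congr_fun h g).trans hg)
  rw [← FreeProductTwoThree.lift_range uRep vRep uRep_pow vRep_pow]
  exact ⟨g, rfl⟩

theorem orderOf_u : orderOf u = 2 := by
  refine orderOf_eq_prime u_pow fun h => ?_
  have h1 := mk_eq_one_of_mem_closure (Subgroup.subset_closure (by simp)) (T := uRep) h
  have h2 : uPerm (fun _ => true, false) = (fun _ => true, false) :=
    congrArg (fun T : fullGroupRep stateMeasure tapeGroup => T.1 (fun _ => true, false)) h1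
  simp [uPerm_false] at h2

theorem orderOf_v : orderOf v = 3 := by
  refine orderOf_eq_prime v_pow fun h => ?_
  have h1 := mk_eq_one_of_mem_closure (Subgroup.subset_closure (by simp)) (T := vRep) h
  have h2 : vPerm (fun _ => true, false) = (fun _ => true, false) :=
    congrArg (fun T : fullGroupRep stateMeasure tapeGroup => T.1 (fun _ => true, false)) h1
  have h3 := (vPerm_mem_ascending (p := (fun _ => true, false)) ⟨fun _ _ => rfl, rfl⟩).2
  rw [h2] at h3
  exact Bool.false_ne_true h3

/-! ### An element of infinite order with finite orbits -/

/-- The signs of the exponents of `v` in the word `u v⁻¹ u v⁻¹ u v u v`, read from the right. -/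
def sign : ZMod 4 → Bool := ![true, true, false, false]

/-- The property of the word that makes the machine cycle. -/
theorem sign_add_two (i : ZMod 4) : sign (i + 2) = !sign i := by
  revert i; decide

theorem add_two_add_two (i : ZMod 4) : i + 2 + 2 = i := by
  revert i; decide

/-- `v` or its inverse. -/
def vSigned (b : Bool) : Equiv.Perm State := bif b then vPerm else vPerm⁻¹

/-- One step of the word: apply `v` or its inverse according to the phase, and then `u`. -/
def step : Equiv.Perm (State × ZMod 4) where
  toFun a := (uPerm (vSigned (sign a.2) a.1), a.2 + 1)
  invFun a := ((vSigned (sign (a.2 - 1)))⁻¹ (uPerm⁻¹ a.1), a.2 - 1)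
  left_inv a := by simp
  right_inv a := by simp

theorem step_apply (p : State) (i : ZMod 4) :
    step (p, i) = (uPerm (vSigned (sign i) p), i + 1) := rfl

/-- The state `b` is reached from the state `a` in finitely many steps. -/
def Reaches (a b : State × ZMod 4) : Prop := ∃ n : ℕ, step^[n] a = b

namespace Reaches

variable {a b c : State × ZMod 4}

theorem trans (h : Reaches a b) (h' : Reaches b c) : Reaches a c := by
  obtain ⟨m, rfl⟩ := h
  obtain ⟨n, rfl⟩ := h'
  exact ⟨n + m, Function.iterate_add_apply _ _ _ _⟩

theorem of_step (h : step a = b) : Reaches a b := ⟨1, h⟩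

/-- A state that reaches a periodic state is periodic. -/
theorem mem_periodicPts (h : Reaches a b) (hb : b ∈ Function.periodicPts step) :
    a ∈ Function.periodicPts step := by
  obtain ⟨n, rfl⟩ := h
  obtain ⟨m, hm, hb⟩ := hb
  refine ⟨m, hm, step.injective.iterate n ?_⟩
  change step^[m] (step^[n] a) = step^[n] a at hb
  rwa [← Function.iterate_add_apply, add_comm, Function.iterate_add_apply] at hb

end Reaches

/-- `Reaches` allows zero steps; the separate first step makes the period positive. -/
theorem mem_periodicPts_of_step {a b : State × ZMod 4} (h : step a = b) (h' : Reaches b a) :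
    a ∈ Function.periodicPts step := by
  obtain ⟨n, hn⟩ := h'
  refine ⟨n + 1, n.succ_pos, ?_⟩
  change step^[n + 1] a = a
  rw [Function.iterate_succ_apply, h, hn]

/-- The tape with the head moved to the right. -/
def moveRight (x : ℤ → Bool) : ℤ → Bool := fun k => x (k + 1)

/-- The tape with the head moved to the left. -/
def moveLeft (x : ℤ → Bool) : ℤ → Bool := fun k => x (k - 1)

theorem moveRight_moveLeft (x : ℤ → Bool) : moveRight (moveLeft x) = x := by
  funext k
  simp [moveRight, moveLeft]

/-- The tape with the entry at the head replaced by `b`. -/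
def write (x : ℤ → Bool) (b : Bool) : ℤ → Bool := Function.update x 0 b

theorem write_zero (x : ℤ → Bool) (b : Bool) : write x b 0 = b := Function.update_self _ _ _

theorem write_of_ne (x : ℤ → Bool) (b : Bool) {k : ℤ} (hk : k ≠ 0) : write x b k = x k :=
  Function.update_of_ne hk _ _

theorem write_eq_self {x : ℤ → Bool} {b : Bool} (h : x 0 = b) : write x b = x := by
  rw [← h]
  exact Function.update_eq_self _ _

theorem vSigned_write (s b S : Bool) (x : ℤ → Bool) : vSigned s (write x b, S) =
    (write x ((bif s then vLocal else vLocal.symm) (b, S)).1,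
      ((bif s then vLocal else vLocal.symm) (b, S)).2) := by
  cases s
  · change vPerm⁻¹ _ = _
    rw [vPerm_inv_apply]
    simp [write]
  · change vPerm _ = _
    rw [vPerm_apply]
    simp [write]

/-- The head stands on a zero with signal `0`. -/
theorem step_write_false_false (x : ℤ → Bool) (i : ZMod 4) :
    step ((write x false, false), i) = ((moveRight (write x false), true), i + 1) := by
  rw [step_apply, vSigned_write]
  cases sign i <;> rfl

/-- The head stands on a one with signal `0`. -/
theorem step_write_true_false (x : ℤ → Bool) (i : ZMod 4) :
    step ((write x true, false), i) = ((moveLeft (write x (!sign i)), false), i + 1) := by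
  rw [step_apply, vSigned_write]
  cases sign i <;> rfl

/-- The signal is `1` and the entry at the head equals the sign. -/
theorem step_sign_true (x : ℤ → Bool) (i : ZMod 4) :
    step ((write x (sign i), true), i) = ((moveRight (write x true), true), i + 1) := by
  rw [step_apply, vSigned_write]
  cases sign i <;> rfl

/-- The signal is `1` and the entry at the head differs from the sign. -/
theorem step_not_sign_true (x : ℤ → Bool) (i : ZMod 4) :
    step ((write x (!sign i), true), i) = ((moveLeft (write x (sign i)), false), i + 1) := by
  rw [step_apply, vSigned_write]
  cases sign i <;> rfl

/-- There are exactly `j` ones to the left of the head before the first zero. -/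
def HasHeight (x : ℤ → Bool) (j : ℕ) : Prop :=
  (∀ k : ℤ, -j ≤ k → k < 0 → x k = true) ∧ x (-j - 1) = false

theorem HasHeight.up {x : ℤ → Bool} {j : ℕ} (h : HasHeight x j) :
    HasHeight (moveRight (write x true)) (j + 1) := by
  refine ⟨fun k h1 h2 => ?_, ?_⟩
  · push_cast at h1
    by_cases hk : k + 1 = 0
    · simp only [moveRight, hk, write_zero]
    · simp only [moveRight, write_of_ne x true hk]
      exact h.1 _ (by omega) (by omega)
  · have h3 : (-((j + 1 : ℕ) : ℤ) - 1 + 1) = -j - 1 := by push_cast; ring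
    simp only [moveRight]
    rw [h3, write_of_ne x true (by omega)]
    exact h.2

/-- The phase after the traversal of a finite tree of height `j`. -/
def exitPhase (j : ℕ) (i : ZMod 4) : ZMod 4 := if Even j then i + 1 else i + 3

/-- From the top of a finite tree of height `j` the machine traverses a part of the tree and returns
to the parent of the top, with the tape unchanged. -/
def Returns (x : ℤ → Bool) (j : ℕ) : Prop :=
  ∀ i b, Reaches ((moveLeft (write x b), false), i) ((write x b, true), exitPhase j i)

section

variable {x : ℤ → Bool} {j : ℕ}

theorem Returns.flip (h : Returns x j) (i : ZMod 4) :
    Reaches ((write x (!sign i), true), i) ((write x (sign i), true), exitPhase j (i + 1)) :=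
  (Reaches.of_step (step_not_sign_true x i)).trans (h _ _)

theorem Returns.enter (h : Returns x j) (i : ZMod 4) :
    Reaches ((write x true, false), i) ((write x (!sign i), true), exitPhase j (i + 1)) :=
  (Reaches.of_step (step_write_true_false x i)).trans (h _ _)

theorem reaches_up (x : ℤ → Bool) (i : ZMod 4) :
    Reaches ((write x (sign i), true), i) ((moveRight (write x true), true), i + 1) :=
  Reaches.of_step (step_sign_true x i)

theorem exitPhase_even (hj : Even j) (i : ZMod 4) : exitPhase j (i + 1) = i + 2 := by
  rw [exitPhase, if_pos hj, add_assoc]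
  rfl

theorem exitPhase_odd (hj : ¬Even j) (i : ZMod 4) : exitPhase j (i + 1) = i := by
  rw [exitPhase, if_neg hj]
  revert i; decide

/-- The head leaves `!sign i` behind on its way down. For even `j` it comes back two phases later,
when this entry equals the sign, and it leaves to the right. For odd `j` it comes back at phase `i`,
has to flip the entry and make a second excursion, and only then leaves. -/
theorem Returns.traverse (h : Returns x j) (i : ZMod 4) :
    Reaches ((write x true, false), i)
      ((moveRight (write x true), true), exitPhase (j + 1) i) := by
  by_cases hj : Even j
  · have h1 := h.enter i
    rw [exitPhase_even hj, ← sign_add_two] at h1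
    have h2 := h1.trans (reaches_up x (i + 2))
    rw [exitPhase, if_neg (by simpa [Nat.even_add_one] using hj)]
    rwa [add_assoc] at h2
  · have h1 := h.enter i
    have h2 := h.flip i
    rw [exitPhase_odd hj] at h1 h2
    rw [exitPhase, if_pos (by simpa [Nat.even_add_one] using hj)]
    exact (h1.trans h2).trans (reaches_up x i)

/-- Induction on the height: at height 0 the head meets a zero and turns back at once; at height `j
+ 1` it traverses the tree of height `j` below. -/
theorem HasHeight.returns (h : HasHeight x j) : Returns x j := by
  induction j generalizing x with
  | zero =>
    intro i b
    have h0 : moveLeft (write x b) 0 = false :=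
      (write_of_ne x b (by norm_num)).trans (by simpa using h.2)
    have h1 := step_write_false_false (moveLeft (write x b)) i
    rw [write_eq_self h0, moveRight_moveLeft] at h1
    exact Reaches.of_step h1
  | succ j ih =>
    intro i b
    have h0 : moveLeft (write x b) 0 = true :=
      (write_of_ne x b (by norm_num)).trans (h.1 _ (by push_cast; omega) (by norm_num))
    have h2 : HasHeight (moveLeft (write x b)) j := by
      refine ⟨fun k h1 h2 => ?_, ?_⟩
      · exact (write_of_ne x b (by omega)).trans (h.1 _ (by push_cast; omega) (by omega))
      · refine (write_of_ne x b (by omega)).trans ?_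
        rw [← h.2]
        congr 1
        push_cast
        ring
    have h1 := (ih h2).traverse i
    rwa [write_eq_self h0, moveRight_moveLeft] at h1

/-- An excursion from odd height returns at the same phase, so an entry of the wrong sign has been
corrected when the head comes back. -/
theorem HasHeight.reaches_up_of_odd (h : HasHeight x j) (hj : ¬Even j) (i : ZMod 4) :
    Reaches ((x, true), i) ((moveRight (write x true), true), i + 1) := by
  by_cases hx : x 0 = sign i
  · have := reaches_up x i
    rwa [write_eq_self hx] at this
  · have h1 := h.returns.flip i
    rw [exitPhase_odd hj, write_eq_self (Bool.eq_not_of_ne hx)] at h1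
    exact h1.trans (reaches_up x i)

theorem reaches_up_of_eq {i : ZMod 4} (hx : x 0 = sign i) :
    Reaches ((x, true), i) ((moveRight (write x true), true), i + 1) := by
  have := reaches_up x i
  rwa [write_eq_self hx] at this

/-- An excursion from even height shifts the phase by two, so the corrected entry is wrong again on
return. A second excursion restores both the entry and the phase. -/
theorem HasHeight.periodic_of_even (h : HasHeight x j) (hj : Even j) (i : ZMod 4)
    (hx : x 0 ≠ sign i) : ((x, true), i) ∈ Function.periodicPts step := by
  have h1 := h.returns.flip (i + 2)
  have h2 := h.returns (i + 1) (sign i)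
  have h3 : exitPhase j (i + 1) = i + 2 := exitPhase_even hj i
  rw [exitPhase_even hj, sign_add_two, Bool.not_not, add_two_add_two,
    write_eq_self (Bool.eq_not_of_ne hx)] at h1
  rw [h3] at h2
  have h4 := step_not_sign_true x i
  rw [write_eq_self (Bool.eq_not_of_ne hx)] at h4
  exact mem_periodicPts_of_step h4 (h2.trans h1)

end

/-! ### Blocks of four ones stop the ascent. -/

theorem moveRight_write_of_nonneg (x : ℤ → Bool) (b : Bool) {k : ℤ} (hk : 0 ≤ k) :
    moveRight (write x b) k = x (k + 1) := write_of_ne x b (by omega)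

/-- The entries 0 and 2 are met at even heights and at phases two apart, where the signs are
opposite. Being equal, they cannot both match; the entry between them is met at odd height and does
not matter. -/
theorem periodic_of_three_ones {x : ℤ → Bool} {j : ℕ} (h : HasHeight x j) (hj : Even j)
    (h0 : x 0 = true) (h2 : x 2 = true) (i : ZMod 4) :
    ((x, true), i) ∈ Function.periodicPts step := by
  by_cases hi : x 0 = sign i
  · have h3 : ¬Even (j + 1) := by simpa [Nat.even_add_one] using hj
    refine ((reaches_up_of_eq hi).trans
      (h.up.reaches_up_of_odd h3 (i + 1))).mem_periodicPts ?_
    refine h.up.up.periodic_of_even (by simpa [Nat.even_add_one] using hj) _ ?_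
    rw [moveRight_write_of_nonneg _ _ le_rfl, moveRight_write_of_nonneg _ _ (by norm_num),
      add_assoc i, show (1 : ZMod 4) + 1 = 2 from rfl, sign_add_two, ← hi, h0]
    norm_num [h2]
  · exact h.periodic_of_even hj i hi

theorem periodic_of_four_ones {x : ℤ → Bool} {j : ℕ} (h : HasHeight x j)
    (h0 : x 0 = true) (h1 : x 1 = true) (h2 : x 2 = true) (h3 : x 3 = true) (i : ZMod 4) :
    ((x, true), i) ∈ Function.periodicPts step := by
  by_cases hj : Even j
  · exact periodic_of_three_ones h hj h0 h2 i
  · refine (h.reaches_up_of_odd hj i).mem_periodicPts ?_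
    refine periodic_of_three_ones h.up (by simpa [Nat.even_add_one] using hj) ?_ ?_ _
    · rwa [moveRight_write_of_nonneg _ _ le_rfl]
    · rwa [moveRight_write_of_nonneg _ _ (by norm_num)]

/-- Induction on the distance to the block: the head either is caught in a cycle or moves one place
to the right, and entries to its right are still untouched. -/
theorem periodic_of_isBlock {x : ℤ → Bool} {j : ℕ} (h : HasHeight x j) {m : ℕ}
    (hm : IsBlock x 4 m) (i : ZMod 4) : ((x, true), i) ∈ Function.periodicPts step := by
  induction m generalizing x j i with
  | zero =>
    have hx : ∀ k : ℤ, 0 ≤ k → k < 4 → x k = true := fun k h1 h2 =>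
      hm.1 k (by simpa using h1) (by simpa using h2)
    exact periodic_of_four_ones h (hx 0 le_rfl (by norm_num)) (hx 1 (by norm_num) (by norm_num))
      (hx 2 (by norm_num) (by norm_num)) (hx 3 (by norm_num) (by norm_num)) i
  | succ m ih =>
    have hm' : IsBlock (moveRight (write x true)) 4 m := by
      have := hm.congr (y := moveRight (write x true)) (k := 1) fun k h1 _ =>
        moveRight_write_of_nonneg x true (by push_cast at h1; omega)
      simpa using this
    by_cases hj : Even j
    · by_cases hi : x 0 = sign i
      · exact (reaches_up_of_eq hi).mem_periodicPts (ih h.up hm' _)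
      · exact h.periodic_of_even hj i hi
    · exact (h.reaches_up_of_odd hj i).mem_periodicPts (ih h.up hm' _)

theorem IsGeneric.exists_hasHeight {p : State} (hp : IsGeneric p) : ∃ j, HasHeight p.1 j := by
  obtain ⟨m, hm, hb⟩ := hp.exists_left 0 (-1)
  have hex : ∃ j : ℕ, p.1 (-j - 1) = false := by
    refine ⟨(-m - 1).toNat, ?_⟩
    rw [← hb.2]
    exact congrArg p.1 (by push_cast at hm; omega)
  classical
  refine ⟨Nat.find hex, fun k h1 h2 => ?_, Nat.find_spec hex⟩
  have := Nat.find_min hex (m := (-k - 1).toNat) (by omega)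
  rw [Bool.not_eq_false] at this
  rw [← this]
  exact congrArg p.1 (by omega)

theorem IsGeneric.periodic_true {p : State} (hp : IsGeneric p) (i : ZMod 4) :
    ((p.1, true), i) ∈ Function.periodicPts step := by
  obtain ⟨j, hj⟩ := hp.exists_hasHeight
  obtain ⟨m, hm, hb⟩ := hp.exists_right 4 0
  lift m to ℕ using hm
  exact periodic_of_isBlock hj hb i

theorem IsGeneric.periodic {p : State} (hp : IsGeneric p) (i : ZMod 4) :
    (p, i) ∈ Function.periodicPts step := by
  obtain ⟨x, _ | _⟩ := p
  -- A state with signal 0 is the start of an excursion from the position to its right; its return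
  -- has signal 1.
  · have hq : IsGeneric (moveRight x, false) :=
      hp.of_orbitRel (orbit_of_mem shift_mem rfl)
    obtain ⟨j, hj⟩ := hq.exists_hasHeight
    have h1 := hj.returns i (moveRight x 0)
    have h2 : moveLeft (moveRight x) = x := by
      funext k
      simp [moveRight, moveLeft]
    rw [write_eq_self rfl, h2] at h1
    exact h1.mem_periodicPts (hq.periodic_true _)
  · exact hp.periodic_true i

/-- The element `u v⁻¹ u v⁻¹ u v u v`. -/
def word : fullGroupRep stateMeasure tapeGroup :=
  uRep * vRep⁻¹ * (uRep * vRep⁻¹) * (uRep * vRep) * (uRep * vRep)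

theorem word_mem_closure : word ∈ Subgroup.closure {uRep, vRep} := by
  have hu : uRep ∈ Subgroup.closure {uRep, vRep} := Subgroup.subset_closure (by simp)
  have hv : vRep ∈ Subgroup.closure {uRep, vRep} := Subgroup.subset_closure (by simp)
  have h1 := Subgroup.mul_mem _ hu hv
  have h2 := Subgroup.mul_mem _ hu (Subgroup.inv_mem _ hv)
  exact Subgroup.mul_mem _ (Subgroup.mul_mem _ (Subgroup.mul_mem _ h2 h2) h1) h1

theorem step_iterate_four (p : State) : step^[4] (p, 0) = (word.1 p, 0) := by
  change step (step (step (step (p, 0)))) = _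
  simp only [step_apply]
  exact Prod.ext rfl (show (0 + 1 + 1 + 1 + 1 : ZMod 4) = 0 by decide)

theorem step_iterate_four_mul (n : ℕ) (p : State) :
    step^[4 * n] (p, 0) = ((word ^ n).1 p, 0) := by
  induction n with
  | zero => rfl
  | succ n ih =>
    rw [mul_add_one, add_comm, Function.iterate_add_apply, ih, step_iterate_four, pow_succ']
    rfl

theorem IsGeneric.exists_word_pow {p : State} (hp : IsGeneric p) :
    ∃ n > 0, (word ^ n).1 p = p := by
  obtain ⟨n, hn, h⟩ := hp.periodic 0
  refine ⟨n, hn, ?_⟩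
  have h1 := step_iterate_four_mul n p
  -- Since `4 * n` is a multiple of the period `n`, divisibility of the period by 4 is not needed.
  rw [mul_comm 4 n, (h.mul_const 4).eq] at h1
  exact (Prod.ext_iff.1 h1).1.symm

/-- On a run of ones that is infinite to the left the head moves left under either sign, so the
entries to its right recede by one place. The bound `1 ≤ k` excludes the entry at the head, which
may be rewritten. -/
theorem uPerm_vSigned_descending (b : Bool) {p : State} (hp : p ∈ descending) :
    uPerm (vSigned b p) ∈ descending ∧
      ∀ k : ℤ, 1 ≤ k → (uPerm (vSigned b p)).1 (k + 1) = p.1 k := by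
  have h1 : vSigned b p ∈ ascending := by
    cases b
    · exact vPerm_inv_mem_ascending hp
    · exact vPerm_mem_ascending hp
  refine ⟨uPerm_mem_descending h1, fun k hk => ?_⟩
  have h2 : (uPerm (vSigned b p)).1 (k + 1) = (vSigned b p).1 k := by
    have h3 : vSigned b p = ((vSigned b p).1, true) := Prod.ext rfl h1.2
    rw [h3, uPerm_true]
    simp
  have h4 := congrArg (fun q : State => q.1 k) (vSigned_write b (p.1 0) p.2 p.1)
  rw [write_eq_self rfl] at h4
  exact h2.trans (h4.trans (write_of_ne _ _ (by omega)))

theorem word_descending {p : State} (hp : p ∈ descending) :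
    word.1 p ∈ descending ∧ ∀ k : ℤ, 1 ≤ k → (word.1 p).1 (k + 4) = p.1 k := by
  obtain ⟨h1, e1⟩ := uPerm_vSigned_descending true hp
  obtain ⟨h2, e2⟩ := uPerm_vSigned_descending true h1
  obtain ⟨h3, e3⟩ := uPerm_vSigned_descending false h2
  obtain ⟨h4, e4⟩ := uPerm_vSigned_descending false h3
  refine ⟨h4, fun k hk => ?_⟩
  have h5 : k + 4 = k + 1 + 1 + 1 + 1 := by ring
  rw [h5]
  exact (e4 (k + 1 + 1 + 1) (by omega)).trans ((e3 (k + 1 + 1) (by omega)).trans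
    ((e2 (k + 1) (by omega)).trans (e1 k hk)))

theorem word_pow_descending (n : ℕ) {p : State} (hp : p ∈ descending) :
    (word ^ n).1 p ∈ descending ∧ ∀ k : ℤ, 1 ≤ k → ((word ^ n).1 p).1 (k + 4 * n) = p.1 k := by
  induction n with
  | zero => exact ⟨hp, fun k _ => by simp⟩
  | succ n ih =>
    obtain ⟨h1, e1⟩ := word_descending ih.1
    rw [pow_succ']
    refine ⟨h1, fun k hk => ?_⟩
    rw [← ih.2 k hk, ← e1 _ (by omega)]
    have h5 : k + 4 * ((n + 1 : ℕ) : ℤ) = k + 4 * n + 4 := by push_cast; ring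
    rw [h5]
    rfl

theorem word_pow_ne_one {n : ℕ} (hn : 0 < n) : word ^ n ≠ 1 := by
  intro h
  -- The last one of this tape is at position 1, and `word ^ n` carries it to position `1 + 4 * n`,
  -- where the tape has a zero.
  have hp : ((fun k => decide (k ≤ 1), false) : State) ∈ descending :=
    ⟨fun k hk => decide_eq_true (by omega), rfl⟩
  have h1 := (word_pow_descending n hp).2 1 le_rfl
  rw [h] at h1
  have h2 : decide ((1 : ℤ) + 4 * n ≤ 1) = decide ((1 : ℤ) ≤ 1) := h1
  simp at h2
  omega

end TuringMachine

/-! ### The 2-norm -/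

namespace OrbitEquivalence

section

variable {X : Type*} [MeasurableSpace X] [StandardBorelSpace X] {μ : Measure X}
  {G : Subgroup (Equiv.Perm X)} [IsPMP μ G] [IsProbabilityMeasure μ]

theorem norm_koopman_traceVector (T : fullGroupRep μ G) :
    ‖((koopman (FullGroup.mk T)).1 : HilbertSp μ G →L[ℂ] HilbertSp μ G) (traceVector μ G)‖ =
      ‖traceVector μ G‖ :=
  (koopmanIso T).norm_map _

theorem norm_traceVector : ‖traceVector μ G‖ = 1 := by
  have h := trace_koopman (1 : fullGroupRep μ G)
  rw [map_one, map_one] at h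
  have h1 : trace (1 : UnitaryGroup μ G).1 = inner ℂ (traceVector μ G) (traceVector μ G) := rfl
  have h2 : μ.real {x | (1 : fullGroupRep μ G).1 x = x} = 1 := by simp
  rw [h1, h2] at h
  have h3 : ‖traceVector μ G‖ ^ 2 = 1 := by
    rw [← inner_self_eq_norm_sq (𝕜 := ℂ), h]
    simp
  exact (pow_eq_one_iff_of_nonneg (norm_nonneg _) two_ne_zero).1 h3

/-- The distance of `u_T` to the identity in the 2-norm. -/
theorem dist_koopman_one_sq (T : fullGroupRep μ G) :
    dist (koopman (FullGroup.mk T)) 1 ^ 2 = 2 * μ.real {x | T.1 x ≠ x} := by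
  have h1 : dist (koopman (FullGroup.mk T)) 1 = ‖((koopman (FullGroup.mk T)).1 :
      HilbertSp μ G →L[ℂ] HilbertSp μ G) (traceVector μ G) - traceVector μ G‖ :=
    twoNorm_eq _
  have h2 : (inner ℂ (traceVector μ G) (((koopman (FullGroup.mk T)).1 :
      HilbertSp μ G →L[ℂ] HilbertSp μ G) (traceVector μ G))) = (μ.real {x | T.1 x = x} : ℂ) :=
    trace_koopman T
  -- The square is `2 - 2 Re τ(u_T)`, and the trace is the measure of the fixed points.
  rw [h1, norm_sub_rev, @norm_sub_sq ℂ, norm_koopman_traceVector, norm_traceVector, h2]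
  have h3 : μ.real {x | T.1 x = x} + μ.real {x | T.1 x ≠ x} = 1 :=
    (measureReal_add_measureReal_compl
      (measurableSet_eq_fun T.2.1.measurable measurable_id)).trans probReal_univ
  have h4 : RCLike.re (μ.real {x | T.1 x = x} : ℂ) = μ.real {x | T.1 x = x} := Complex.ofReal_re _
  rw [h4]
  linarith

theorem koopman_injective : Function.Injective (koopman (μ := μ) (G := G)) := by
  refine (injective_iff_map_eq_one _).2 fun g hg => ?_
  obtain ⟨T, rfl⟩ := FullGroup.mk_surjective g
  have h := dist_koopman_one_sq T
  rw [hg, dist_self] at h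
  have h1 : μ.real {x | T.1 x ≠ x} = 0 := by linarith
  rw [measureReal_eq_zero_iff] at h1
  exact FullGroup.mk_eq_one.2 h1

end

end OrbitEquivalence

namespace TuringMachine

open OrbitEquivalence

/-! ### Elements of small support -/

/-- Factorial exponents form a divisibility chain, so the supports decrease. A state in all of them
has an infinite orbit under `word`, hence is not generic, and continuity from above applies. -/
theorem tendsto_measure_word_pow : Filter.Tendsto
    (fun n : ℕ => stateMeasure {p | (word ^ n.factorial).1 p ≠ p}) Filter.atTop (nhds 0) := by
  have hmeas : ∀ n : ℕ, MeasurableSet {p | (word ^ n.factorial).1 p ≠ p} := fun n =>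
    (measurableSet_eq_fun (word ^ n.factorial).2.1.measurable measurable_id).compl
  have hfix : ∀ (m n : ℕ) (p : State), (word ^ m).1 p = p → m ∣ n → (word ^ n).1 p = p := by
    rintro m _ p h ⟨k, rfl⟩
    rw [pow_mul]
    induction k with
    | zero => rfl
    | succ k ih =>
      rw [pow_succ]
      change ((word ^ m) ^ k).1 ((word ^ m).1 p) = p
      rw [h, ih]
  have h := tendsto_measure_iInter_atTop (μ := stateMeasure)
    (fun n => (hmeas n).nullMeasurableSet)
    (fun m n hmn p hp h => hp (hfix _ _ p h (Nat.factorial_dvd_factorial hmn)))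
    ⟨0, measure_ne_top _ _⟩
  have h0 : stateMeasure (⋂ n : ℕ, {p | (word ^ n.factorial).1 p ≠ p}) = 0 := by
    refine measure_mono_null (fun p hp => ?_) ae_isGeneric
    intro hg
    obtain ⟨n, hn, h⟩ := IsGeneric.exists_word_pow hg
    exact Set.mem_iInter.1 hp n (hfix _ _ p h (Nat.dvd_factorial hn le_rfl))
  rwa [h0] at h

/-- There are elements of the group generated by `u` and `v` with small support. -/
theorem exists_small_support {ε : ℝ} (hε : 0 < ε) :
    ∃ T : fullGroupRep stateMeasure tapeGroup, FullGroup.mk T ∈ Subgroup.closure {u, v} ∧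
      FullGroup.mk T ≠ 1 ∧ stateMeasure.real {p | T.1 p ≠ p} < ε := by
  have h1 := (tendsto_order.1 tendsto_measure_word_pow).2 (ENNReal.ofReal ε)
    (ENNReal.ofReal_pos.2 hε)
  obtain ⟨n, hn⟩ := h1.exists
  have hmem : word ^ n.factorial ∈ Subgroup.closure {uRep, vRep} :=
    Subgroup.pow_mem _ word_mem_closure _
  refine ⟨word ^ n.factorial, ?_, fun h => ?_, ?_⟩
  · have h2 := Subgroup.mem_map_of_mem FullGroup.mk hmem
    rwa [MonoidHom.map_closure, Set.image_pair] at h2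
  · exact word_pow_ne_one n.factorial_pos (mk_eq_one_of_mem_closure hmem h)
  · rw [measureReal_def]
    exact ENNReal.toReal_lt_of_lt_ofReal hn

theorem not_discreteTopology_closure : ¬DiscreteTopology (Subgroup.closure {u, v}) := by
  intro h
  obtain ⟨ε, hε, hball⟩ := Metric.isOpen_singleton_iff.1
    (isOpen_discrete ({1} : Set (Subgroup.closure {u, v})))
  obtain ⟨T, hT, hT1, hs⟩ := exists_small_support hε
  refine hT1 (congrArg Subtype.val (hball ⟨FullGroup.mk T, hT⟩ ?_))
  have hd : dist (FullGroup.mk T) 1 = stateMeasure.real {p | T.1 p ≠ p} := by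
    change (FullGroup.mk T * 1⁻¹).length = _
    rw [inv_one, mul_one, FullGroup.length_mk]
  exact hd.trans_lt hs

theorem not_discreteTopology_closure_koopman :
    ¬DiscreteTopology (Subgroup.closure {koopman u, koopman v}) := by
  intro h
  obtain ⟨ε, hε, hball⟩ := Metric.isOpen_singleton_iff.1
    (isOpen_discrete ({1} : Set (Subgroup.closure {koopman u, koopman v})))
  -- The squared distance of `u_T` to 1 is twice the measure of the support, hence `ε ^ 2 / 2`.
  obtain ⟨T, hT, hT1, hs⟩ := exists_small_support (ε := ε ^ 2 / 2) (by positivity)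
  have hmem : koopman (FullGroup.mk T) ∈ Subgroup.closure {koopman u, koopman v} := by
    have h2 := Subgroup.mem_map_of_mem koopman hT
    rwa [MonoidHom.map_closure, Set.image_pair] at h2
  refine hT1 (koopman_injective ((congrArg Subtype.val (hball ⟨_, hmem⟩ ?_)).trans
    (map_one koopman).symm))
  refine lt_of_pow_lt_pow_left₀ 2 hε.le ((dist_koopman_one_sq T).trans_lt ?_)
  linarith

end TuringMachine

end

theorem mainTheorem6 :
    -- the orbit equivalence relation is ergodic and hyperfinite
    ErgodicSMul TuringMachine.tapeGroup TuringMachine.State TuringMachine.stateMeasure ∧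
    OrbitEquivalence.IsHyperfinite TuringMachine.stateMeasure TuringMachine.tapeGroup ∧
    -- `u` and `v` generate a copy of `PSL(2, ℤ)` in its full group
    orderOf TuringMachine.u = 2 ∧ orderOf TuringMachine.v = 3 ∧
    (∃ φ : PSL(2, ℤ) →*
        OrbitEquivalence.FullGroup TuringMachine.stateMeasure TuringMachine.tapeGroup,
      Function.Injective φ ∧
      φ ((ModularGroup.S : SL(2, ℤ)) : PSL(2, ℤ)) = TuringMachine.u ∧
      φ ((ModularGroup.S * ModularGroup.T : SL(2, ℤ)) : PSL(2, ℤ)) = TuringMachine.v ∧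
      φ.range = Subgroup.closure {TuringMachine.u, TuringMachine.v}) ∧
    -- this copy is not discrete in the full group with the metric `d`
    ¬ DiscreteTopology (Subgroup.closure {TuringMachine.u, TuringMachine.v}) ∧
    -- it embeds in the unitary group of the von Neumann algebra of the relation, where it is not
    -- discrete for the 2-norm
    Set.InjOn OrbitEquivalence.koopman
      (Subgroup.closure {TuringMachine.u, TuringMachine.v} :
        Set (OrbitEquivalence.FullGroup TuringMachine.stateMeasure TuringMachine.tapeGroup)) ∧
    ¬ DiscreteTopology (Subgroup.closure {OrbitEquivalence.koopman TuringMachine.u,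
      OrbitEquivalence.koopman TuringMachine.v}) := by
  refine ⟨TuringMachine.ergodicSMul, TuringMachine.isHyperfinite, TuringMachine.orderOf_u,
    TuringMachine.orderOf_v, ?_, TuringMachine.not_discreteTopology_closure,
    OrbitEquivalence.koopman_injective.injOn, TuringMachine.not_discreteTopology_closure_koopman⟩
  exact FreeProductTwoThree.exists_psl_hom TuringMachine.u_pow TuringMachine.v_pow
    TuringMachine.lift_injective
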